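/- **Setting.** Let $(E,C)$ be a finite bipartite separated graph: $E$ is a finite directed graph with $E^0=E^{0,0}\sqcup E^{0,1}$, $r(E^1)=E^{0,0}$ and $s(E^1)=E^{0,1}$, and $C=\bigsqcup_{v} C_v$, where, for $v\in E^{0,0}$, $C_v$ is a partition of $r^{-1}(v)$ into nonempty sets, and $C_v=\emptyset$ for $v\in E^{0,1}$. *Canonical sequence.* Put $(E_0,C^0)=(E,C)$. Given $(E_n,C^n)$, write $C^n_u=\{X^u_1,\dots,X^u_{k_u}\}$ for $u\in E_n^{0,0}$. Then $E_{n+1}^{0,0}=E_n^{0,1}$; $E_{n+1}^{0,1}$ consists of vertices $v(x_1,\dots,x_{k_u})$, one for each $u\in E_n^{0,0}$ and $(x_1,\dots,x_{k_u})\in\prod_i X^u_i$; $E_{n+1}^1$ consists of arrows $\alpha^{x_i}(x_1,\dots,\widehat{x_i},\dots,x_{k_u})$, one for each such family and each $1\le i\le k_u$, with source $v(x_1,\dots,x_{k_u})$ and range $s(x_i)$; and, for $w\in E_{n+1}^{0,0}$, $C^{n+1}_w=\{X(x)\mid x\in E_n^1,\ s(x)=w\}$, where for $x=x_i\in X_i^u$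 the set $X(x)$ consists of the arrows $\alpha^{x}(x_1,\dots,\widehat{x_i},\dots,x_{k_u})$ with $x_j\in X^u_j$, $j\neq i$. (These are the new vertices, arrows and sets of the multiresolution at $E_n^{0,0}$.) *Algebras.* For a field with involution $K$, $L(E,C)=L_K(E,C)$ is the $*$-algebra over $K$ with generators $E^0\sqcup E^1$ and relations $vv'=\delta_{v,v'}v$, $v=v^*$; $r(e)e=es(e)=e$; $e^*e'=\delta_{e,e'}s(e)$ for $e,e'\in X\in C$; and $v=\sum_{e\in X}ee^*$ for $X\in C_v$. The graph C*-algebra $C^*(E,C)$ is the enveloping C*-algebra of $L_{\mathbb C}(E,C)$. Let $\phi_n\colon L(E_n,C^n)\to L(E_{n+1},C^{n+1})$ be the $*$-homomorphism with $$\phi_n(u)=\sum_{(x_1,\dots,x_{k_u})\in\prod_i X_i^u}v(x_1,\dots,x_{k_u})\ (u\in E_n^{0,0}),\qquad \phi_n(w)=w\ (w\in E_n^{0,1}),\qquad \phi_n(x)=\sum_{y\in X(x)}y^*\ (x\in E_n^1),$$ and put $\Phi_n=\phi_{n-1}\circ\cdots\circ\phi_0\colon L(E,C)\to L(E_n,C^n)$.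 The same formulas define $*$-homomorphisms $\Phi_n\colon C^*(E,C)\to C^*(E_n,C^n)$. For an element $w$ of one of these algebras put $e(w)=ww^*$. **Theorem 5.6.** Let $n\ge 1$. 1. For every field with involution $K$, let $J_n$ be the two-sided ideal of $L_K(E,C)$ generated by all commutators $[e(w),e(w')]$, where $w,w'$ are products of at least one and at most $n$ elements of $\{x,x^*\mid x\in E^1\}$. Then $\ker\Phi_n=J_n$, and $\Phi_n$ induces a $*$-isomorphism $L_K(E,C)/J_n\cong L_K(E_n,C^n)$. 2. Let $J_n$ now be the closed two-sided ideal of $C^*(E,C)$ generated by all commutators $[e(w),e(w')]$, where $w,w'$ are products of at least one and at most $n$ elements of $\{x,x^*\mid x\in E^1\}\subseteq C^*(E,C)$. Then the kernel of $\Phi_n\colon C^*(E,C)\to C^*(E_n,C^n)$ is $J_n$, and $\Phi_n$ induces a $*$-isomorphism $C^*(E,C)/J_n\cong C^*(E_n,C^n)$. -/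

import Mathlib

universe u v

set_option linter.unusedSectionVars false

noncomputable section

/-! ## Finite bipartite separated graphs and the canonical sequence -/

/-- A finite bipartite separated graph `(E, C)`.

* `V0` is the set `E^{0,0}` of range vertices and `V1` the set `E^{0,1}` of source vertices, so
  that `E^0 = V0 ⊔ V1`, and `Edge` is `E^1`.
* `Block` is the set `C`, the disjoint union of the `C_v`: a block `X : Block` stands for the set
  of edges `{e | block e = X}`, and `C_v` consists of the blocks `X` with `base X = v`. As `block`
  is surjective, the blocks are nonempty pairwise disjoint sets of edges, and an edge `e` has
  range `base (block e)`, so `C_v` is a partition of `r⁻¹(v)`; every partition arises so.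
  For `v` in `V1` there is no edge with range `v`, and `C_v` is empty.
* `base_surjective` says that no vertex of `V0` is a source, `source_surjective` that every vertex
  of `V1` emits an edge. -/
structure BipartiteSepGraph where
  V0 : Type u
  V1 : Type u
  Edge : Type u
  Block : Type u
  block : Edge → Block
  base : Block → V0
  source : Edge → V1
  block_surjective : Function.Surjective block
  base_surjective : Function.Surjective base
  source_surjective : Function.Surjective source
  [fintypeV0 : Fintype V0]
  [fintypeV1 : Fintype V1]
  [fintypeEdge : Fintype Edge]
  [fintypeBlock : Fintype Block]

namespace BipartiteSepGraph

attribute [instance] fintypeV0 fintypeV1 fintypeEdge fintypeBlock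

/-- The range of an edge. -/
def range (G : BipartiteSepGraph.{u}) (e : G.Edge) : G.V0 := G.base (G.block e)

/-- The families `(x_1, …, x_k) ∈ X_1 × ⋯ × X_k`, where `C_v = {X_1, …, X_k}`. -/
abbrev Choice (G : BipartiteSepGraph.{u}) (v : G.V0) : Type u :=
  ∀ X : {X : G.Block // G.base X = v}, {e : G.Edge // G.block e = X.1}

/-- The new vertices `v(x_1, …, x_k)` of the multiresolution of `(E, C)` at all the vertices of
`E^{0,0}`. -/
abbrev NewVertex (G : BipartiteSepGraph.{u}) : Type u := Σ v : G.V0, G.Choice v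

/-- The new arrows of the multiresolution at all the vertices of `E^{0,0}`. The arrow
`α^{x_i}(x_1, …, x_{i-1}, x_{i+1}, …, x_k)` is the pair of the family `(x_1, …, x_k)` and the
block `X_i` (`x_i` being the member of the family in `X_i`). -/
abbrev NewEdge (G : BipartiteSepGraph.{u}) : Type u :=
  Σ p : G.NewVertex, {X : G.Block // G.base X = p.1}

/-- The edge `x_i` of `E` that the new arrow `α^{x_i}(x_1, …, x_{i-1}, x_{i+1}, …, x_k)` comes
from. -/
def parent (G : BipartiteSepGraph.{u}) (a : G.NewEdge) : G.Edge := (a.1.2 a.2).1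

theorem parent_surjective (G : BipartiteSepGraph.{u}) : Function.Surjective G.parent := by
  classical
  intro e
  let f : G.Choice (G.range e) := fun X =>
    if h : G.block e = X.1 then ⟨e, h⟩
    else ⟨(G.block_surjective X.1).choose, (G.block_surjective X.1).choose_spec⟩
  refine ⟨⟨⟨G.range e, f⟩, ⟨G.block e, rfl⟩⟩, ?_⟩
  simp [parent, f]

/-- The next term of the canonical sequence. If `(E, C) = (E_n, C^n)`, then
`E_{n+1}^{0,0} = E_n^{0,1}`; `E_{n+1}^{0,1}` consists of the new vertices and `E_{n+1}^1` of the
new arrows of the multiresolution of `(E_n, C^n)` at `E_n^{0,0}`; the new arrow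
`α = α^{x_i}(x_1, …, x_{i-1}, x_{i+1}, …, x_k)` has source `v(x_1, …, x_k)` and range `s(x_i)`; and
`C^{n+1}_w` consists of the sets `X(x) = {α | parent α = x}`, one for each edge `x` of `E_n` with
`s(x) = w`. -/
def next (G : BipartiteSepGraph.{u}) : BipartiteSepGraph.{u} where
  V0 := G.V1
  V1 := G.NewVertex
  Edge := G.NewEdge
  Block := G.Edge
  block := G.parent
  base := G.source
  source := fun a => a.1
  block_surjective := G.parent_surjective
  base_surjective := G.source_surjective
  source_surjective := fun p =>
    ⟨⟨p, ⟨(G.base_surjective p.1).choose, (G.base_surjective p.1).choose_spec⟩⟩, rfl⟩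
  fintypeV0 := G.fintypeV1
  fintypeV1 := Fintype.ofFinite _
  fintypeEdge := Fintype.ofFinite _
  fintypeBlock := G.fintypeEdge

/-- The canonical sequence `(E_n, C^n)` of bipartite separated graphs of `(E, C)`. -/
def canonical (G : BipartiteSepGraph.{u}) : ℕ → BipartiteSepGraph.{u}
  | 0 => G
  | n + 1 => (G.canonical n).next

/-- The vertices of a bipartite separated graph. -/
abbrev Vertex (G : BipartiteSepGraph.{u}) : Type u := G.V0 ⊕ G.V1

end BipartiteSepGraph

/-! ## The free `*`-algebra -/

/-- The free unital `*`-algebra over `K` on a set `X`: the free algebra on two copies of `X`, the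
second copy standing for the adjoints of the elements of the first one. -/
def FreeStarAlgebra (K : Type v) [Field K] (X : Type u) : Type (max u v) := FreeAlgebra K (X ⊕ X)

namespace FreeStarAlgebra

variable (K : Type v) [Field K] (X : Type u)

instance : Ring (FreeStarAlgebra K X) := inferInstanceAs (Ring (FreeAlgebra K (X ⊕ X)))

instance : Algebra K (FreeStarAlgebra K X) := inferInstanceAs (Algebra K (FreeAlgebra K (X ⊕ X)))

variable {X}

/-- The generators. -/
def gen (x : X) : FreeStarAlgebra K X := FreeAlgebra.ι K (Sum.inl x)

/-- The adjoints of the generators. -/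
def genStar (x : X) : FreeStarAlgebra K X := FreeAlgebra.ι K (Sum.inr x)

variable {K}

theorem induction {p : FreeStarAlgebra K X → Prop} (alg : ∀ r, p (algebraMap K _ r))
    (gen : ∀ x, p (gen K x)) (genStar : ∀ x, p (genStar K x))
    (mul : ∀ a b, p a → p b → p (a * b)) (add : ∀ a b, p a → p b → p (a + b))
    (a : FreeStarAlgebra K X) : p a :=
  FreeAlgebra.induction K (X ⊕ X) (motive := p) alg (fun x => x.casesOn gen genStar) mul add a

/-- The homomorphism from the free algebra with prescribed values. -/
def liftAlg {A : Type*} [Ring A] [Algebra K A] (f g : X → A) : FreeStarAlgebra K X →ₐ[K] A :=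
  FreeAlgebra.lift K (Sum.elim f g)

@[simp] theorem liftAlg_gen {A : Type*} [Ring A] [Algebra K A] (f g : X → A) (x : X) :
    liftAlg f g (gen K x) = f x :=
  FreeAlgebra.lift_ι_apply (Sum.elim f g) (Sum.inl x)

@[simp] theorem liftAlg_genStar {A : Type*} [Ring A] [Algebra K A] (f g : X → A) (x : X) :
    liftAlg f g (genStar K x) = g x :=
  FreeAlgebra.lift_ι_apply (Sum.elim f g) (Sum.inr x)

variable [StarRing K]

/-- The opposite of the free algebra, with scalars acting through the involution of `K`. -/
@[reducible]
def conjAlgebra : Algebra K (FreeStarAlgebra K X)ᵐᵒᵖ :=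
  RingHom.toAlgebra' ((algebraMap K (FreeStarAlgebra K X)ᵐᵒᵖ).comp (starRingEnd K))
    (fun c x => Algebra.commutes (starRingEnd K c) x)

/-- The involution as a homomorphism to the opposite ring. -/
def starHom : FreeStarAlgebra K X →+* (FreeStarAlgebra K X)ᵐᵒᵖ :=
  letI := conjAlgebra (K := K) (X := X)
  (liftAlg (K := K) (fun x => MulOpposite.op (genStar K x))
    (fun x => MulOpposite.op (gen K x))).toRingHom

theorem starHom_gen (x : X) : starHom (gen K x) = MulOpposite.op (genStar K x) := by
  let := conjAlgebra (K := K) (X := X)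
  exact liftAlg_gen _ _ x

theorem starHom_genStar (x : X) : starHom (genStar K x) = MulOpposite.op (gen K x) := by
  let := conjAlgebra (K := K) (X := X)
  exact liftAlg_genStar _ _ x

theorem starHom_algebraMap (r : K) :
    starHom (algebraMap K (FreeStarAlgebra K X) r) =
      MulOpposite.op (algebraMap K (FreeStarAlgebra K X) (star r)) := by
  let := conjAlgebra (K := K) (X := X)
  exact AlgHom.commutes (liftAlg (K := K) (fun x => MulOpposite.op (genStar K x))
    (fun x => MulOpposite.op (gen K x))) r

/-- The involution: conjugate-linear, antimultiplicative, and exchanging the two copies of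
`X`. -/
instance : StarRing (FreeStarAlgebra K X) where
  star a := (starHom a).unop
  star_involutive a := by
    induction a using induction with
    | alg r => simp [starHom_algebraMap]
    | gen x => simp [starHom_gen, starHom_genStar]
    | genStar x => simp [starHom_gen, starHom_genStar]
    | mul a b ha hb => simp_all
    | add a b ha hb => simp_all
  star_mul a b := by simp
  star_add a b := by simp

@[simp] theorem star_gen (x : X) : star (gen K x) = genStar K x := by
  change (starHom (gen K x)).unop = _
  simp [starHom_gen]

@[simp] theorem star_genStar (x : X) : star (genStar K x) = gen K x := by
  change (starHom (genStar K x)).unop = _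
  simp [starHom_genStar]

theorem star_algebraMap' (r : K) :
    star (algebraMap K (FreeStarAlgebra K X) r) = algebraMap K _ (star r) := by
  change (starHom (algebraMap K (FreeStarAlgebra K X) r)).unop = _
  simp [starHom_algebraMap]

instance : StarModule K (FreeStarAlgebra K X) where
  star_smul r a := by
    rw [Algebra.smul_def, star_mul, star_algebraMap', ← Algebra.commutes, ← Algebra.smul_def]

theorem liftAlg_star {A : Type*} [Ring A] [StarRing A] [Algebra K A] [StarModule K A] (f : X → A)
    (a : FreeStarAlgebra K X) :
    liftAlg f (fun x => star (f x)) (star a) = star (liftAlg f (fun x => star (f x)) a) := by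
  induction a using induction with
  | alg r =>
    rw [star_algebraMap', AlgHom.commutes, AlgHom.commutes, algebraMap_star_comm]
  | gen x => simp
  | genStar x => simp
  | mul a b ha hb => simp [ha, hb]
  | add a b ha hb => simp [ha, hb]

end FreeStarAlgebra

/-! ## The Leavitt path algebra -/

namespace BipartiteSepGraph

variable (K : Type v) [Field K] (G : BipartiteSepGraph.{u})

/-- The image of a vertex in the free `*`-algebra on `E^0 ⊔ E^1`. -/
abbrev freeVertex (p : G.Vertex) : FreeStarAlgebra K (G.Vertex ⊕ G.Edge) :=
  FreeStarAlgebra.gen K (Sum.inl p)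

/-- The image of an edge in the free `*`-algebra on `E^0 ⊔ E^1`. -/
abbrev freeEdge (e : G.Edge) : FreeStarAlgebra K (G.Vertex ⊕ G.Edge) :=
  FreeStarAlgebra.gen K (Sum.inr e)

open scoped Classical in
/-- The defining relations (V), (E), (SCK1), (SCK2) of the Leavitt path algebra, and their
adjoints. As `E^0` is finite, the sum of the vertices is a unit of the `*`-algebra which they
present; the relation `one` makes it the unit of the free `*`-algebra. -/
inductive LeavittRel [StarRing K] :
    FreeStarAlgebra K (G.Vertex ⊕ G.Edge) → FreeStarAlgebra K (G.Vertex ⊕ G.Edge) → Prop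
  | vertex_mul (p q : G.Vertex) : LeavittRel (G.freeVertex K p * G.freeVertex K q)
      (if p = q then G.freeVertex K p else 0)
  | vertex_star (p : G.Vertex) : LeavittRel (G.freeVertex K p) (star (G.freeVertex K p))
  | range_mul (e : G.Edge) :
      LeavittRel (G.freeVertex K (Sum.inl (G.range e)) * G.freeEdge K e) (G.freeEdge K e)
  | mul_source (e : G.Edge) :
      LeavittRel (G.freeEdge K e * G.freeVertex K (Sum.inr (G.source e))) (G.freeEdge K e)
  | sck1 (e f : G.Edge) (h : G.block e = G.block f) :
      LeavittRel (star (G.freeEdge K e) * G.freeEdge K f)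
        (if e = f then G.freeVertex K (Sum.inr (G.source e)) else 0)
  | sck2 (X : G.Block) : LeavittRel (G.freeVertex K (Sum.inl (G.base X)))
      (∑ e with G.block e = X, G.freeEdge K e * star (G.freeEdge K e))
  | one : LeavittRel 1 (∑ p : G.Vertex, G.freeVertex K p)
  | adjoint {a b : FreeStarAlgebra K (G.Vertex ⊕ G.Edge)} (h : LeavittRel a b) :
      LeavittRel (star a) (star b)

/-- The Leavitt path algebra `L_K(E, C)`. -/
def Leavitt [StarRing K] : Type (max u v) := RingQuot (LeavittRel K G)

namespace Leavitt

variable [StarRing K]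

instance : Ring (Leavitt K G) := inferInstanceAs (Ring (RingQuot (LeavittRel K G)))

instance : Algebra K (Leavitt K G) := inferInstanceAs (Algebra K (RingQuot (LeavittRel K G)))

instance : StarRing (Leavitt K G) :=
  RingQuot.starRing (LeavittRel K G) (fun _ _ h => LeavittRel.adjoint h)

/-- The quotient map from the free `*`-algebra. -/
def mk : FreeStarAlgebra K (G.Vertex ⊕ G.Edge) →ₐ[K] Leavitt K G :=
  RingQuot.mkAlgHom K (LeavittRel K G)

variable {K G}

theorem mk_surjective : Function.Surjective (mk K G) :=
  RingQuot.mkAlgHom_surjective K (LeavittRel K G)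

theorem mk_rel {a b : FreeStarAlgebra K (G.Vertex ⊕ G.Edge)} (h : LeavittRel K G a b) :
    mk K G a = mk K G b :=
  RingQuot.mkAlgHom_rel K h

theorem mk_star (a : FreeStarAlgebra K (G.Vertex ⊕ G.Edge)) :
    mk K G (star a) = star (mk K G a) := by
  let := RingQuot.starRing (LeavittRel K G) (fun _ _ h => LeavittRel.adjoint h)
  change RingQuot.mkAlgHom K (LeavittRel K G) (star a) =
    star (RingQuot.mkAlgHom K (LeavittRel K G) a)
  simp only [RingQuot.mkAlgHom_def, RingQuot.mkRingHom_def]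
  rfl

instance : StarModule K (Leavitt K G) where
  star_smul r a := by
    obtain ⟨a, rfl⟩ := mk_surjective a
    rw [← map_smul, ← mk_star, star_smul, map_smul, mk_star]

variable (K) in
/-- The image of a vertex in `L_K(E, C)`. -/
def vertex (p : G.Vertex) : Leavitt K G := mk K G (G.freeVertex K p)

variable (K) in
/-- The image of an edge in `L_K(E, C)`. -/
def edge (e : G.Edge) : Leavitt K G := mk K G (G.freeEdge K e)

end Leavitt

open scoped Classical in
/-- Families of elements of a unital `*`-algebra indexed by the vertices and edges of `G`
which satisfy the defining relations of `L_K(E, C)`. -/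
structure IsFamily {G : BipartiteSepGraph.{u}} {A : Type*} [Ring A] [StarRing A]
    (P : G.Vertex → A) (S : G.Edge → A) : Prop where
  vertex_mul : ∀ p q, P p * P q = if p = q then P p else 0
  vertex_star : ∀ p, P p = star (P p)
  range_mul : ∀ e, P (Sum.inl (G.range e)) * S e = S e
  mul_source : ∀ e, S e * P (Sum.inr (G.source e)) = S e
  sck1 : ∀ e f, G.block e = G.block f →
    star (S e) * S f = if e = f then P (Sum.inr (G.source e)) else 0
  sck2 : ∀ X, P (Sum.inl (G.base X)) = ∑ e with G.block e = X, S e * star (S e)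
  one : 1 = ∑ p, P p

namespace Leavitt

variable [StarRing K] {K G}

/-- The canonical family in `L_K(E, C)`. -/
theorem isFamily : IsFamily (vertex K (G := G)) (edge K (G := G)) where
  vertex_mul p q := by
    have h := mk_rel (LeavittRel.vertex_mul (K := K) p q)
    rw [map_mul] at h
    refine h.trans ?_
    split_ifs
    · rfl
    · exact map_zero _
  vertex_star p := by
    have h := mk_rel (LeavittRel.vertex_star (K := K) p)
    rwa [mk_star] at h
  range_mul e := by
    have h := mk_rel (LeavittRel.range_mul (K := K) e)
    rwa [map_mul] at h
  mul_source e := by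
    have h := mk_rel (LeavittRel.mul_source (K := K) e)
    rwa [map_mul] at h
  sck1 e f hef := by
    have h := mk_rel (LeavittRel.sck1 (K := K) e f hef)
    rw [map_mul, mk_star] at h
    refine h.trans ?_
    split_ifs
    · rfl
    · exact map_zero _
  sck2 X := by
    have h := mk_rel (LeavittRel.sck2 (K := K) X)
    simp only [map_sum, map_mul, mk_star] at h
    exact h
  one := by
    have h := mk_rel (LeavittRel.one (K := K) (G := G))
    simp only [map_sum, map_one] at h
    exact h

section lift

variable {A : Type*} [Ring A] [StarRing A] [Algebra K A] [StarModule K A]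
  {P : G.Vertex → A} {S : G.Edge → A}

/-- The `*`-homomorphism from the free `*`-algebra with prescribed values. -/
def freeLift (P : G.Vertex → A) (S : G.Edge → A) :
    FreeStarAlgebra K (G.Vertex ⊕ G.Edge) →ₐ[K] A :=
  FreeStarAlgebra.liftAlg (Sum.elim P S) (fun x => star (Sum.elim P S x))

theorem freeLift_star (a : FreeStarAlgebra K (G.Vertex ⊕ G.Edge)) :
    freeLift P S (star a) = star (freeLift P S a) :=
  FreeStarAlgebra.liftAlg_star _ a

@[simp] theorem freeLift_vertex (p : G.Vertex) :
    freeLift (K := K) P S (G.freeVertex K p) = P p :=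
  FreeStarAlgebra.liftAlg_gen _ _ _

@[simp] theorem freeLift_edge (e : G.Edge) :
    freeLift (K := K) P S (G.freeEdge K e) = S e :=
  FreeStarAlgebra.liftAlg_gen _ _ _

theorem freeLift_rel (h : IsFamily P S) {a b : FreeStarAlgebra K (G.Vertex ⊕ G.Edge)}
    (hab : LeavittRel K G a b) : freeLift P S a = freeLift P S b := by
  induction hab with
  | vertex_mul p q =>
    rw [map_mul, freeLift_vertex, freeLift_vertex, h.vertex_mul]
    split_ifs <;> simp
  | vertex_star p => rw [freeLift_star, freeLift_vertex]; exact h.vertex_star p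
  | range_mul e => rw [map_mul, freeLift_vertex, freeLift_edge]; exact h.range_mul e
  | mul_source e => rw [map_mul, freeLift_vertex, freeLift_edge]; exact h.mul_source e
  | sck1 e f hef =>
    rw [map_mul, freeLift_star, freeLift_edge, freeLift_edge, h.sck1 e f hef]
    split_ifs <;> simp
  | sck2 X =>
    simp only [map_sum, map_mul, freeLift_star, freeLift_vertex, freeLift_edge]
    exact h.sck2 X
  | one =>
    simp only [map_sum, map_one, freeLift_vertex]
    exact h.one
  | adjoint _ ih => rw [freeLift_star, freeLift_star, ih]

/-- The universal property of `L_K(E, C)`. -/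
def lift (h : IsFamily P S) : Leavitt K G →⋆ₐ[K] A where
  __ := (RingQuot.liftAlgHom K ⟨freeLift P S, fun _ _ hab => freeLift_rel h hab⟩ :
    RingQuot (LeavittRel K G) →ₐ[K] A)
  map_star' a := by
    obtain ⟨a, rfl⟩ := mk_surjective a
    rw [← mk_star]
    have key : ∀ b, (RingQuot.liftAlgHom K ⟨freeLift P S, fun _ _ hab => freeLift_rel h hab⟩ :
        RingQuot (LeavittRel K G) →ₐ[K] A) (mk K G b) = freeLift P S b := fun b =>
      RingQuot.liftAlgHom_mkAlgHom_apply K _ _ b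
    exact (key (star a)).trans ((freeLift_star a).trans (congrArg star (key a).symm))

theorem lift_mk (h : IsFamily P S) (a : FreeStarAlgebra K (G.Vertex ⊕ G.Edge)) :
    lift (K := K) h (mk K G a) = freeLift P S a :=
  RingQuot.liftAlgHom_mkAlgHom_apply K _ _ a

@[simp] theorem lift_vertex (h : IsFamily P S) (p : G.Vertex) :
    lift (K := K) h (vertex K p) = P p :=
  (lift_mk h _).trans (freeLift_vertex p)

@[simp] theorem lift_edge (h : IsFamily P S) (e : G.Edge) :
    lift (K := K) h (edge K e) = S e :=
  (lift_mk h _).trans (freeLift_edge e)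

end lift

end Leavitt

/-! ## The connecting homomorphisms -/

/-- The vertex `u` of `E_n^{0,0}` which a new vertex `v(x_1, …, x_k)` comes from. -/
def root (G : BipartiteSepGraph.{u}) (q : G.next.V1) : G.V0 := Sigma.fst (β := G.Choice) q

theorem root_source (a : G.next.Edge) : G.root (G.next.source a) = G.range (G.next.block a) := by
  obtain ⟨q, X⟩ := a
  change q.1 = G.base (G.block (q.2 X).1)
  rw [(q.2 X).2, X.2]

theorem next_edge_ext {a b : G.next.Edge} (hs : G.next.source a = G.next.source b)
    (hb : G.block (G.next.block a) = G.block (G.next.block b)) : a = b := by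
  obtain ⟨q, X⟩ := a
  obtain ⟨q', X'⟩ := b
  obtain rfl : q = q' := hs
  have h : X.1 = X'.1 := (q.2 X).2.symm.trans (hb.trans (q.2 X').2)
  rw [Subtype.ext h]

theorem exists_next_edge (q : G.next.V1) (X : G.Block) (h : G.base X = G.root q) :
    ∃ a : G.next.Edge, G.next.source a = q ∧ G.block (G.next.block a) = X :=
  ⟨(⟨q, ⟨X, h⟩⟩ : G.NewEdge), rfl, (Sigma.snd (β := G.Choice) q ⟨X, h⟩).2⟩

variable [StarRing K]

open scoped Classical in
/-- `φ_n` on vertices: `φ_n(u) = ∑ v(x_1, …, x_k)` for `u` in `E_n^{0,0}`, where the sum is over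
`X_1 × ⋯ × X_k` with `C_u = {X_1, …, X_k}`, and `φ_n(w) = w` for `w` in `E_n^{0,1}`. -/
def phiVertex : G.Vertex → Leavitt K G.next :=
  Sum.elim (fun u => ∑ q : G.next.V1 with G.root q = u, Leavitt.vertex K (G := G.next) (Sum.inr q))
    (fun w => Leavitt.vertex K (G := G.next) (Sum.inl w))

open scoped Classical in
/-- `φ_n` on edges: `φ_n(x) = ∑ y^*`, where the sum is over the arrows `y` in `X(x)`. -/
def phiEdge (x : G.Edge) : Leavitt K G.next :=
  ∑ y : G.next.Edge with G.next.block y = x, star (Leavitt.edge K (G := G.next) y)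

theorem phi_isFamily : IsFamily (G.phiVertex K) (G.phiEdge K) := by
  classical
  have F := Leavitt.isFamily (K := K) (G := G.next)
  have hP0 : ∀ u, G.phiVertex K (Sum.inl u) =
      ∑ q : G.next.V1 with G.root q = u, Leavitt.vertex K (G := G.next) (Sum.inr q) :=
    fun u => by rw [phiVertex, Sum.elim_inl]
  have hP1 : ∀ w, G.phiVertex K (Sum.inr w) = Leavitt.vertex K (G := G.next) (Sum.inl w) :=
    fun w => by rw [phiVertex, Sum.elim_inr]
  have hS : ∀ x, G.phiEdge K x = ∑ y : G.next.Edge with G.next.block y = x,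
      star (Leavitt.edge K (G := G.next) y) := fun x => rfl
  generalize hP : G.phiVertex K = P at *
  generalize hS' : G.phiEdge K = S at *
  generalize hV : Leavitt.vertex K (G := G.next) = V at *
  generalize hE : Leavitt.edge K (G := G.next) = T at *
  have srcStar : ∀ y, V (Sum.inr (G.next.source y)) * star (T y) = star (T y) := fun y => by
    have h := congrArg star (F.mul_source y)
    rwa [star_mul, ← F.vertex_star] at h
  have rangeStar : ∀ y, star (T y) * V (Sum.inl (G.next.range y)) = star (T y) := fun y => by
    have h := congrArg star (F.range_mul y)
    rwa [star_mul, ← F.vertex_star] at h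
  have starS : ∀ x, star (S x) = ∑ y : G.next.Edge with G.next.block y = x, T y := fun x => by
    rw [hS, star_sum]
    simp only [star_star]
  have TT : ∀ y z, T y * star (T z) =
      if G.next.source y = G.next.source z then T y * star (T z) else 0 := fun y z => by
    split_ifs with h
    · rfl
    · rw [← F.mul_source y, ← srcStar z, mul_assoc, ← mul_assoc (V _) (V _), F.vertex_mul,
        if_neg (by simpa using h), zero_mul, mul_zero]
  refine ⟨?_, ?_, ?_, ?_, ?_, ?_, ?_⟩
  · rintro (u | w) (u' | w')
    · rw [hP0, hP0, Finset.sum_mul_sum]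
      simp only [F.vertex_mul, Sum.inr.injEq, Sum.inl.injEq, Finset.sum_ite_eq,
        Finset.mem_filter, Finset.mem_univ, true_and]
      split_ifs with h
      · subst h
        refine Finset.sum_congr rfl fun q hq => ?_
        rw [if_pos (by simpa using hq)]
      · refine Finset.sum_eq_zero fun q hq => ?_
        rw [if_neg]
        rintro rfl
        exact h (Finset.mem_filter.1 hq).2.symm
    · rw [hP0, hP1, Finset.sum_mul]
      simp [F.vertex_mul]
    · rw [hP0, hP1, Finset.mul_sum]
      simp [F.vertex_mul]
    · rw [hP1, hP1, F.vertex_mul]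
      by_cases h : w = w'
      · subst h
        rw [if_pos rfl, if_pos rfl]
      · exact (if_neg fun h' => h (Sum.inl_injective h')).trans
          (if_neg fun h' => h (Sum.inr_injective h')).symm
  · rintro (u | w)
    · rw [hP0, star_sum]
      exact Finset.sum_congr rfl fun q _ => F.vertex_star _
    · rw [hP1]
      exact F.vertex_star _
  · intro x
    rw [hP0, hS, Finset.mul_sum]
    refine Finset.sum_congr rfl fun y hy => ?_
    rw [← srcStar y, ← mul_assoc, Finset.sum_mul]
    congr 1
    simp only [F.vertex_mul, Sum.inr.injEq]
    rw [Finset.sum_ite_eq']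
    rw [if_pos]
    simp only [Finset.mem_filter, Finset.mem_univ, true_and] at hy ⊢
    rw [root_source, hy]
  · intro x
    rw [hP1, hS, Finset.sum_mul]
    refine Finset.sum_congr rfl fun y hy => ?_
    simp only [Finset.mem_filter, Finset.mem_univ, true_and] at hy
    subst hy
    exact rangeStar y
  · intro x x' hx
    rw [starS, hS, Finset.sum_mul_sum]
    split_ifs with h
    · subst h
      have e : V (Sum.inl (G.source x)) =
          ∑ y : G.next.Edge with G.next.block y = x, T y * star (T y) := F.sck2 x
      rw [hP1, e]
      refine Finset.sum_congr rfl fun y hy => ?_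
      rw [Finset.sum_eq_single y]
      · intro z hz hzy
        rw [TT, if_neg]
        intro hs
        simp only [Finset.mem_filter, Finset.mem_univ, true_and] at hy hz
        exact hzy (next_edge_ext G hs.symm (by rw [hy, hz]))
      · intro h
        exact absurd hy h
    · refine Finset.sum_eq_zero fun y hy => Finset.sum_eq_zero fun z hz => ?_
      rw [TT, if_neg]
      intro hs
      simp only [Finset.mem_filter, Finset.mem_univ, true_and] at hy hz
      have := next_edge_ext G hs (by rw [hy, hz, hx])
      subst this
      exact h (hy.symm.trans hz)
  · intro X
    have e : ∀ x, S x * star (S x) =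
        ∑ y : G.next.Edge with G.next.block y = x, V (Sum.inr (G.next.source y)) := fun x => by
      rw [starS, hS, Finset.sum_mul_sum]
      refine Finset.sum_congr rfl fun y hy => ?_
      rw [Finset.sum_eq_single y]
      · rw [F.sck1 y y rfl, if_pos rfl]
      · intro z hz hzy
        simp only [Finset.mem_filter, Finset.mem_univ, true_and] at hy hz
        rw [F.sck1 y z (hy.trans hz.symm), if_neg (Ne.symm hzy)]
      · intro h
        exact absurd hy h
    simp only [e]
    rw [hP0, Finset.sum_sigma']
    symm
    refine Finset.sum_bij (fun p _ => G.next.source p.2) ?_ ?_ ?_ ?_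
    · rintro ⟨x, y⟩ h
      simp only [Finset.mem_sigma, Finset.mem_filter, Finset.mem_univ, true_and] at h ⊢
      rw [root_source, h.2, range, h.1]
    · rintro ⟨x, y⟩ h ⟨x', y'⟩ h' hs
      simp only [Finset.mem_sigma, Finset.mem_filter, Finset.mem_univ, true_and] at h h'
      obtain ⟨h1, rfl⟩ := h
      obtain ⟨h1', rfl⟩ := h'
      obtain rfl := next_edge_ext G hs (h1.trans h1'.symm)
      rfl
    · intro q hq
      simp only [Finset.mem_filter, Finset.mem_univ, true_and] at hq
      obtain ⟨y, hy, hy'⟩ := G.exists_next_edge q X hq.symm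
      exact ⟨⟨G.next.block y, y⟩, Finset.mem_sigma.2 ⟨Finset.mem_filter.2 ⟨Finset.mem_univ _, hy'⟩,
        Finset.mem_filter.2 ⟨Finset.mem_univ _, rfl⟩⟩, hy⟩
    · intro p _
      rfl
  · rw [F.one, Fintype.sum_sum_type, Fintype.sum_sum_type, add_comm]
    congr 1
    · simp only [hP0]
      exact (Finset.sum_fiberwise (s := Finset.univ) (g := G.root)
        (f := fun q => V (Sum.inr q))).symm
    · exact Finset.sum_congr rfl fun w _ => (hP1 w).symm

/-- The connecting homomorphism `φ_n : L(E_n, C^n) → L(E_{n+1}, C^{n+1})`. -/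
def phi : Leavitt K G →⋆ₐ[K] Leavitt K G.next := Leavitt.lift (G.phi_isFamily K)

/-- The composition `Φ_n = φ_{n-1} ∘ ⋯ ∘ φ_0 : L(E, C) → L(E_n, C^n)`. -/
def Phi : ∀ n, Leavitt K G →⋆ₐ[K] Leavitt K (G.canonical n)
  | 0 => StarAlgHom.id K (Leavitt K G)
  | n + 1 => ((G.canonical n).phi K).comp (Phi n)

end BipartiteSepGraph

/-! ## The enveloping C*-algebra -/

/-- A C*-seminorm on a complex `*`-algebra. -/
structure CStarSeminorm (A : Type*) [Ring A] [StarRing A] [Algebra ℂ A] extends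
    RingSeminorm A where
  smul' : ∀ (c : ℂ) (a : A), toFun (c • a) = ‖c‖ * toFun a
  cstar' : ∀ a : A, toFun (star a * a) = toFun a ^ 2

namespace CStarSeminorm

variable {A : Type*} [Ring A] [StarRing A] [Algebra ℂ A]

instance : FunLike (CStarSeminorm A) A ℝ where
  coe q := q.toFun
  coe_injective q q' h := by
    obtain ⟨⟨⟨q, _, _, _⟩, _⟩, _, _⟩ := q
    obtain ⟨⟨⟨q', _, _, _⟩, _⟩, _, _⟩ := q'
    obtain rfl : q = q' := h
    rfl

instance : RingSeminormClass (CStarSeminorm A) A ℝ where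
  map_add_le_add q := q.add_le'
  map_zero q := q.map_zero'
  map_neg_eq_map q := q.neg'
  map_mul_le_mul q := q.mul_le'

theorem map_smul (q : CStarSeminorm A) (c : ℂ) (a : A) : q (c • a) = ‖c‖ * q a := q.smul' c a

theorem map_star_mul_self (q : CStarSeminorm A) (a : A) : q (star a * a) = q a ^ 2 := q.cstar' a

theorem nonneg (q : CStarSeminorm A) (a : A) : 0 ≤ q a := apply_nonneg q a

theorem map_star_le (q : CStarSeminorm A) (a : A) : q (star a) ≤ q a := by
  by_contra! h
  have h1 : q (star a) ^ 2 ≤ q a * q (star a) := by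
    have := map_mul_le_mul q a (star a)
    rwa [← q.map_star_mul_self, star_star]
  nlinarith [q.nonneg a, q.nonneg (star a)]

/-- The zero seminorm. -/
instance : Inhabited (CStarSeminorm A) where
  default :=
    { toFun := fun _ => 0
      map_zero' := rfl
      add_le' := by simp
      neg' := by simp
      mul_le' := by simp
      smul' := by simp
      cstar' := by simp }

/-- The pullback of a C*-seminorm along a `*`-homomorphism. -/
def comap {B : Type*} [Ring B] [StarRing B] [Algebra ℂ B] (f : A →⋆ₐ[ℂ] B)
    (q : CStarSeminorm B) : CStarSeminorm A where
  toFun a := q (f a)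
  map_zero' := by simp
  add_le' a b := by simpa using map_add_le_add q (f a) (f b)
  neg' a := by simp
  mul_le' a b := by simpa using map_mul_le_mul q (f a) (f b)
  smul' c a := by simp [q.map_smul]
  cstar' a := by rw [← q.map_star_mul_self, map_mul, map_star]

theorem comap_apply {B : Type*} [Ring B] [StarRing B] [Algebra ℂ B] (f : A →⋆ₐ[ℂ] B)
    (q : CStarSeminorm B) (a : A) : q.comap f a = q (f a) := rfl

end CStarSeminorm

/-- A complex `*`-algebra has an enveloping C*-algebra if the values of the C*-seminorms at each
element are bounded. -/
class HasCStarEnvelope (A : Type*) [Ring A] [StarRing A] [Algebra ℂ A] : Prop where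
  bddAbove : ∀ a : A, BddAbove (Set.range fun q : CStarSeminorm A => q a)

/-- The largest C*-seminorm. -/
def maxCStarSeminorm (A : Type*) [Ring A] [StarRing A] [Algebra ℂ A] [HasCStarEnvelope A] :
    CStarSeminorm A where
  toFun a := ⨆ q : CStarSeminorm A, q a
  map_zero' := by simp
  add_le' a b := ciSup_le fun q => (map_add_le_add q a b).trans
    (add_le_add (le_ciSup (HasCStarEnvelope.bddAbove a) q)
      (le_ciSup (HasCStarEnvelope.bddAbove b) q))
  neg' a := by simp
  mul_le' a b := ciSup_le fun q => (map_mul_le_mul q a b).trans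
    (mul_le_mul (le_ciSup (HasCStarEnvelope.bddAbove a) q)
      (le_ciSup (HasCStarEnvelope.bddAbove b) q) (q.nonneg b)
      ((q.nonneg a).trans (le_ciSup (HasCStarEnvelope.bddAbove a) q)))
  smul' c a := by
    simp only [CStarSeminorm.map_smul]
    exact (Real.mul_iSup_of_nonneg (norm_nonneg c) _).symm
  cstar' a := by
    simp only [CStarSeminorm.map_star_mul_self]
    exact (Real.iSup_pow (fun q : CStarSeminorm A => q.nonneg a) 2).symm

theorem le_maxCStarSeminorm {A : Type*} [Ring A] [StarRing A] [Algebra ℂ A] [HasCStarEnvelope A]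
    (q : CStarSeminorm A) (a : A) : q a ≤ maxCStarSeminorm A a :=
  le_ciSup (HasCStarEnvelope.bddAbove a) q

/-- A copy of a `*`-algebra, seminormed by its largest C*-seminorm. -/
def PreEnvelope (A : Type*) : Type _ := A

namespace PreEnvelope

variable (A : Type*) [Ring A] [StarRing A] [Algebra ℂ A]

instance : Ring (PreEnvelope A) := inferInstanceAs (Ring A)
instance : StarRing (PreEnvelope A) := inferInstanceAs (StarRing A)
instance : Algebra ℂ (PreEnvelope A) := inferInstanceAs (Algebra ℂ A)

variable [HasCStarEnvelope A]

instance : SeminormedRing (PreEnvelope A) :=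
  RingSeminorm.toSeminormedRing (R := PreEnvelope A) (maxCStarSeminorm A).toRingSeminorm

theorem norm_def (a : PreEnvelope A) : ‖a‖ = maxCStarSeminorm A a := rfl

instance : NormedAlgebra ℂ (PreEnvelope A) where
  norm_smul_le c a := ((maxCStarSeminorm A).map_smul c a).le

theorem norm_star_le (a : PreEnvelope A) : ‖star a‖ ≤ ‖a‖ := (maxCStarSeminorm A).map_star_le a

theorem norm_star_mul_self (a : PreEnvelope A) : ‖star a * a‖ = ‖a‖ ^ 2 :=
  (maxCStarSeminorm A).map_star_mul_self a

instance : NormedStarGroup (PreEnvelope A) where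
  norm_star_le := norm_star_le A

theorem uniformContinuous_star : UniformContinuous (star : PreEnvelope A → PreEnvelope A) :=
  star_isometry.uniformContinuous

end PreEnvelope

/-- The enveloping C*-algebra of a complex `*`-algebra: the Hausdorff completion with respect to
the largest C*-seminorm. -/
def CStarEnvelope (A : Type*) [Ring A] [StarRing A] [Algebra ℂ A] [HasCStarEnvelope A] : Type _ :=
  UniformSpace.Completion (PreEnvelope A)

namespace CStarEnvelope

variable (A : Type*) [Ring A] [StarRing A] [Algebra ℂ A] [HasCStarEnvelope A]

instance : NormedRing (CStarEnvelope A) :=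
  inferInstanceAs (NormedRing (UniformSpace.Completion (PreEnvelope A)))

instance : CompleteSpace (CStarEnvelope A) :=
  inferInstanceAs (CompleteSpace (UniformSpace.Completion (PreEnvelope A)))

instance : Algebra ℂ (CStarEnvelope A) :=
  inferInstanceAs (Algebra ℂ (UniformSpace.Completion (PreEnvelope A)))

instance : NormedAlgebra ℂ (CStarEnvelope A) where
  norm_smul_le c a := norm_smul_le (β := UniformSpace.Completion (PreEnvelope A)) c a

variable {A}

/-- The canonical map from a `*`-algebra to its enveloping C*-algebra. -/
def of : A →ₐ[ℂ] CStarEnvelope A where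
  __ := (UniformSpace.Completion.coeRingHom :
    PreEnvelope A →+* UniformSpace.Completion (PreEnvelope A))
  commutes' _ := rfl

theorem norm_of (a : A) : ‖of a‖ = maxCStarSeminorm A a :=
  UniformSpace.Completion.norm_coe (E := PreEnvelope A) a

theorem denseRange_of : DenseRange (of : A → CStarEnvelope A) :=
  UniformSpace.Completion.denseRange_coe (α := PreEnvelope A)

instance : Star (CStarEnvelope A) :=
  ⟨UniformSpace.Completion.map (star : PreEnvelope A → PreEnvelope A)⟩

theorem star_of (a : A) : star (of a) = of (star a) :=
  UniformSpace.Completion.map_coe (PreEnvelope.uniformContinuous_star A) (a : PreEnvelope A)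

theorem continuous_star' : Continuous (star : CStarEnvelope A → CStarEnvelope A) :=
  UniformSpace.Completion.continuous_map

instance : StarRing (CStarEnvelope A) where
  star_involutive a := denseRange_of.induction_on a
    (isClosed_eq (continuous_star'.comp continuous_star') continuous_id)
    fun a => by rw [star_of, star_of, star_star]
  star_mul a b := denseRange_of.induction_on₂
    (isClosed_eq (continuous_star'.comp continuous_mul)
      ((continuous_star'.comp continuous_snd).mul (continuous_star'.comp continuous_fst)))
    (fun a b => by rw [← map_mul, star_of, star_of, star_of, star_mul, map_mul]) a b
  star_add a b := denseRange_of.induction_on₂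
    (isClosed_eq (continuous_star'.comp continuous_add)
      ((continuous_star'.comp continuous_fst).add (continuous_star'.comp continuous_snd)))
    (fun a b => by rw [← map_add, star_of, star_of, star_of, star_add, map_add]) a b

instance : CStarRing (CStarEnvelope A) where
  norm_mul_self_le a := denseRange_of.induction_on a
    (isClosed_le (continuous_norm.mul continuous_norm)
      (continuous_norm.comp (continuous_star'.mul continuous_id)))
    fun a => by
      rw [star_of, ← map_mul, norm_of, norm_of, CStarSeminorm.map_star_mul_self, sq]

/-- The enveloping C*-algebra is a C*-algebra. -/
instance [StarModule ℂ A] : CStarAlgebra (CStarEnvelope A) where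
  star_smul c a := denseRange_of.induction_on a
    (isClosed_eq (continuous_star'.comp (continuous_const_smul c))
      ((continuous_const_smul (star c)).comp continuous_star'))
    fun a => by rw [← map_smul, star_of, star_of, star_smul, map_smul]

variable {B : Type*} [Ring B] [StarRing B] [Algebra ℂ B] [HasCStarEnvelope B]

theorem norm_of_map_le (f : A →⋆ₐ[ℂ] B) (a : A) : ‖of (f a)‖ ≤ ‖of a‖ := by
  rw [norm_of, norm_of]
  exact le_maxCStarSeminorm ((maxCStarSeminorm B).comap f) a

/-- A `*`-homomorphism, between the seminormed copies. -/
def preMap (f : A →⋆ₐ[ℂ] B) : PreEnvelope A →+* PreEnvelope B := (f : A →+* B)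

theorem continuous_preMap (f : A →⋆ₐ[ℂ] B) : Continuous (preMap f) := by
  refine AddMonoidHomClass.continuous_of_bound (preMap f) 1 fun a => ?_
  rw [one_mul]
  exact le_maxCStarSeminorm ((maxCStarSeminorm B).comap f) a

/-- The map induced on enveloping C*-algebras as a ring homomorphism. -/
def mapRingHom (f : A →⋆ₐ[ℂ] B) : CStarEnvelope A →+* CStarEnvelope B :=
  UniformSpace.Completion.mapRingHom (preMap f) (continuous_preMap f)

theorem mapRingHom_of (f : A →⋆ₐ[ℂ] B) (a : A) : mapRingHom f (of a) = of (f a) :=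
  UniformSpace.Completion.mapRingHom_coe (continuous_preMap f) a

theorem continuous_mapRingHom (f : A →⋆ₐ[ℂ] B) : Continuous (mapRingHom f) :=
  UniformSpace.Completion.continuous_map (f := preMap f)

/-- The map induced on enveloping C*-algebras by a `*`-homomorphism: its continuous extension. -/
def map (f : A →⋆ₐ[ℂ] B) : CStarEnvelope A →⋆ₐ[ℂ] CStarEnvelope B where
  __ := mapRingHom f
  commutes' c := by
    change mapRingHom f (algebraMap ℂ (CStarEnvelope A) c) = _
    rw [← AlgHom.commutes of c, mapRingHom_of, AlgHomClass.commutes, AlgHom.commutes]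
  map_star' a := denseRange_of.induction_on a
    (isClosed_eq ((continuous_mapRingHom f).comp continuous_star')
      (continuous_star'.comp (continuous_mapRingHom f)))
    fun a => by
      change mapRingHom f (star (of a)) = star (mapRingHom f (of a))
      rw [star_of, mapRingHom_of, mapRingHom_of, star_of, map_star]

@[simp] theorem map_of (f : A →⋆ₐ[ℂ] B) (a : A) : map f (of a) = of (f a) := mapRingHom_of f a

theorem continuous_map (f : A →⋆ₐ[ℂ] B) : Continuous (map f) := continuous_mapRingHom f

end CStarEnvelope

/-! ## The graph C*-algebra -/

namespace BipartiteSepGraph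

namespace Leavitt

variable {G : BipartiteSepGraph.{u}}

theorem seminorm_vertex_le (q : CStarSeminorm (Leavitt ℂ G)) (p : G.Vertex) :
    q (vertex ℂ p) ≤ 1 := by
  have h := q.map_star_mul_self (vertex ℂ p)
  rw [← isFamily.vertex_star, isFamily.vertex_mul, if_pos rfl] at h
  nlinarith [q.nonneg (vertex ℂ p)]

theorem seminorm_edge_le (q : CStarSeminorm (Leavitt ℂ G)) (e : G.Edge) :
    q (edge ℂ e) ≤ 1 := by
  have h := q.map_star_mul_self (edge ℂ e)
  rw [isFamily.sck1 e e rfl, if_pos rfl] at h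
  nlinarith [q.nonneg (edge ℂ e), seminorm_vertex_le q (Sum.inr (G.source e))]

theorem seminorm_one_le (q : CStarSeminorm (Leavitt ℂ G)) : q 1 ≤ 1 := by
  have h := q.map_star_mul_self 1
  rw [star_one, one_mul] at h
  nlinarith [q.nonneg 1]

/-- The C*-seminorms on `L(E, C)` are bounded at each element, since they are at most `1` at the
generators. -/
instance : HasCStarEnvelope (Leavitt ℂ G) where
  bddAbove a := by
    suffices h : ∃ M : ℝ, ∀ q : CStarSeminorm (Leavitt ℂ G), q a ≤ M by
      obtain ⟨M, hM⟩ := h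
      exact ⟨M, by rintro _ ⟨q, rfl⟩; exact hM q⟩
    obtain ⟨a, rfl⟩ := mk_surjective a
    induction a using FreeStarAlgebra.induction with
    | alg r =>
      refine ⟨‖r‖, fun q => ?_⟩
      rw [AlgHom.commutes, Algebra.algebraMap_eq_smul_one, q.map_smul]
      exact mul_le_of_le_one_right (norm_nonneg r) (seminorm_one_le q)
    | gen x =>
      refine ⟨1, fun q => ?_⟩
      rcases x with p | e
      · exact seminorm_vertex_le q p
      · exact seminorm_edge_le q e
    | genStar x =>
      refine ⟨1, fun q => ?_⟩
      rw [← FreeStarAlgebra.star_gen, mk_star]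
      refine (q.map_star_le _).trans ?_
      rcases x with p | e
      · exact seminorm_vertex_le q p
      · exact seminorm_edge_le q e
    | mul a b ha hb =>
      obtain ⟨M, hM⟩ := ha
      obtain ⟨N, hN⟩ := hb
      refine ⟨M * N, fun q => ?_⟩
      rw [map_mul]
      exact (map_mul_le_mul q _ _).trans
        (mul_le_mul (hM q) (hN q) (q.nonneg _) ((q.nonneg _).trans (hM q)))
    | add a b ha hb =>
      obtain ⟨M, hM⟩ := ha
      obtain ⟨N, hN⟩ := hb
      refine ⟨M + N, fun q => ?_⟩
      rw [map_add]
      exact (map_add_le_add q _ _).trans (add_le_add (hM q) (hN q))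

end Leavitt

variable (G : BipartiteSepGraph.{u})

/-- The graph C*-algebra `C*(E, C)`. -/
abbrev GraphCStar : Type u := CStarEnvelope (Leavitt ℂ G)

/-- The canonical image of an edge in `C*(E, C)`. -/
def cstarEdge (e : G.Edge) : G.GraphCStar := CStarEnvelope.of (Leavitt.edge ℂ e)

/-- The connecting homomorphism `φ_n : C*(E_n, C^n) → C*(E_{n+1}, C^{n+1})`, given on the
generators by the same formulas as its algebraic counterpart. -/
def cstarphi : G.GraphCStar →⋆ₐ[ℂ] G.next.GraphCStar := CStarEnvelope.map (G.phi ℂ)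

/-- The composition `Φ_n = φ_{n-1} ∘ ⋯ ∘ φ_0 : C*(E, C) → C*(E_n, C^n)`. -/
def cstarPhi : ∀ n, G.GraphCStar →⋆ₐ[ℂ] (G.canonical n).GraphCStar
  | 0 => StarAlgHom.id ℂ G.GraphCStar
  | n + 1 => (G.canonical n).cstarphi.comp (cstarPhi n)

end BipartiteSepGraph

/-! ## Commutators of final projections -/

/-- The products of at most `n` (and at least one) of the elements `t x` and `(t x)^*`. -/
def words {R ι : Type*} [Ring R] [StarRing R] (t : ι → R) (n : ℕ) : Set R :=
  {w | ∃ l : List R, l ≠ [] ∧ l.length ≤ n ∧ (∀ a ∈ l, ∃ x, a = t x ∨ a = star (t x)) ∧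
    l.prod = w}

/-- The element `e(w) = w w^*`. -/
def finalProj {R : Type*} [Ring R] [StarRing R] (w : R) : R := w * star w

/-- The commutators `[e(w), e(w')]`, where `w` and `w'` are products of at most `n` of the elements
`t x` and `(t x)^*`. -/
def finalProjCommutators {R ι : Type*} [Ring R] [StarRing R] (t : ι → R) (n : ℕ) : Set R :=
  {c | ∃ w ∈ words t n, ∃ w' ∈ words t n, c = ⁅finalProj w, finalProj w'⁆}

/-- The closed two-sided ideal generated by a set, that is, the smallest closed two-sided ideal
containing it. -/
def closedIdealSpan {R : Type*} [Ring R] [TopologicalSpace R] (s : Set R) : TwoSidedIdeal R :=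
  sInf {I | s ⊆ (I : Set R) ∧ IsClosed (I : Set R)}

namespace BipartiteSepGraph

/-- The ideal `J_n` of `L_K(E, C)` generated by the commutators `[e(w), e(w')]`, where `w` and `w'`
are products of at most `n` elements of `{x, x^* : x ∈ E^1}`. -/
def J (K : Type v) [Field K] [StarRing K] (G : BipartiteSepGraph.{u}) (n : ℕ) :
    TwoSidedIdeal (Leavitt K G) :=
  TwoSidedIdeal.span (finalProjCommutators (Leavitt.edge K (G := G)) n)

/-- The closed ideal of `C*(E, C)` generated by the commutators `[e(w), e(w')]`, where `w` and `w'`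
are products of at most `n` elements of `{x, x^* : x ∈ E^1}`. -/
def cstarJ (G : BipartiteSepGraph.{u}) (n : ℕ) : TwoSidedIdeal G.GraphCStar :=
  closedIdealSpan (finalProjCommutators G.cstarEdge n)

end BipartiteSepGraph

end

/-! The algebraic statement is proved one step of the canonical sequence at a time; the C*-statement
then follows from an exactness property of the enveloping C*-algebra.

One step. Under φ the projection xx* becomes the sum of the new vertices whose family contains x
(`phi_finalProj_edge`), so the images of all xx* commute. Conversely, modulo the ideal I generated
by the commutators [xx*, yy*], the products (x_1 x_1*)⋯(x_k x_k*) are orthogonal projections with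
sum u. Sending v(x_1, …, x_k) to this product, and the arrow coming from x_i to x_i* times it, gives
a map from the next Leavitt algebra to L/I whose composite with φ is the quotient map
(`exists_isRefinement`, `isFamily_next`). Hence ker φ ⊆ I (`mem_span_of_phi_eq_zero`). Surjectivity
of φ holds because a new vertex is a product of elements φ(xx*), and the arrow y coming from x is
φ(x)* s(y).

All steps, J_n ⊆ ker Φ_n. Φ_n sends an edge to a sum of edges, or of adjoints of edges, over a set
which is `IsSpread`. Conjugating the span of the vertices by such a sum stays in that span, at worst
after one more φ. As e(tw) = t e(w) t*, a letter costs one step, so Φ_n(e(w)) lies in the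
commutative span of the vertices of E_n when w has length at most n (`Phi_finalProj_list_prod_mem`).

All steps, ker Φ_n ⊆ J_n. By the one-step result, ker Φ_{n+1} is controlled by the commutators of
the aa* with a an edge of E_n. Each aa* lies in the algebra generated by the Φ_n(e(w)) with w of
length at most n + 1 (`finalProj_edge_mem_wordAlgebra`), so these commutators lie in the ideal
generated by the Φ_n-images of the generators of J_{n+1}. Surjectivity of Φ_n lifts this to L(E, C),
and the remaining error lies in ker Φ_n = J_n ⊆ J_{n+1}.

C*-algebras. If f : A → B is onto and a closed self-adjoint ideal I of C*(A) contains the image of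
ker f, the quotient norm of I is a C*-seminorm which descends to B, so ‖x + I‖ ≤ ‖f(x)‖ for the
induced map (`norm_mk_le_norm_map`). This gives both the kernel and the surjectivity of that map. -/

noncomputable section

/-! ## Quotients of C*-algebras and enveloping C*-algebras -/

section CStarQuotient

variable {A : Type*} [CStarAlgebra A]

attribute [local instance] CStarAlgebra.spectralOrder CStarAlgebra.spectralOrderedRing

/-- For `h ≥ 0`, the element `g = (1 + h)⁻¹` is a contraction with `g (1 + h) g ≤ 1`. -/
theorem exists_contraction_of_nonneg {h : A} (hh : 0 ≤ h) :
    ∃ g : A, IsSelfAdjoint g ∧ 1 - g = h * g ∧ ‖g‖ ≤ 1 ∧ g * (1 + h) * g = g := by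
  have hu : IsUnit (1 + h) := CStarAlgebra.isUnit_of_le 1 (by simpa using hh)
  obtain ⟨u, hu⟩ := hu
  have hsa : IsSelfAdjoint (1 + h) := (IsSelfAdjoint.one A).add (IsSelfAdjoint.of_nonneg hh)
  set g : A := ↑u⁻¹ with hg
  have hug : (1 + h) * g = 1 := by rw [← hu, hg, Units.mul_inv]
  have hgu : g * (1 + h) = 1 := by rw [← hu, hg, Units.inv_mul]
  have hstar : IsSelfAdjoint g := by
    have h1 : star g * (1 + h) = 1 := by
      have := congrArg star hug
      rwa [star_mul, hsa.star_eq, star_one] at this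
    calc star g = star g * ((1 + h) * g) := by rw [hug, mul_one]
      _ = g := by rw [← mul_assoc, h1, one_mul]
  refine ⟨g, hstar, ?_, ?_, by rw [hgu, one_mul]⟩
  · rw [add_mul, one_mul] at hug
    rw [← hug]
    abel
  · have h1 : star g * g ≤ g := by
      have h2 : star g * 1 * g ≤ star g * (1 + h) * g :=
        star_left_conjugate_le_conjugate (by simpa using hh) g
      rw [hstar.star_eq] at h2 ⊢
      rwa [mul_one, hgu, one_mul] at h2
    have h3 := CStarAlgebra.norm_le_norm_of_nonneg_of_le (star_mul_self_nonneg g) h1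
    rw [CStarRing.norm_star_mul_self] at h3
    nlinarith [norm_nonneg g]

theorem TwoSidedIdeal.smul_mem {R B : Type*} [CommRing R] [Ring B] [Algebra R B]
    (I : TwoSidedIdeal B) (c : R) {x : B} (hx : x ∈ I) : c • x ∈ I := by
  rw [Algebra.smul_def]
  exact I.mul_mem_left _ _ hx

/-- The C*-inequality for the quotient norm of a self-adjoint two-sided ideal. -/
theorem exists_norm_add_sq_le (I : TwoSidedIdeal A) (hI : ∀ x ∈ I, star x ∈ I) {x i : A}
    (hi : i ∈ I) {c ε : ℝ} (hc : ‖star x * x + i‖ ≤ c) (hε : 0 < ε) :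
    ∃ j ∈ I, ‖x + j‖ ^ 2 ≤ c + ε := by
  have hc0 : 0 ≤ c := (norm_nonneg _).trans hc
  -- The self-adjoint part of i is still in I, and passing to it does not spoil the bound c, since
  -- x*x is self-adjoint.
  set k : A := (1 / 2 : ℝ) • (i + star i) with hk
  have hkI : k ∈ I := by
    have : k = (1 / 2 : ℂ) • (i + star i) := by
      rw [hk, ← Complex.coe_smul]
      norm_num
    rw [this]
    exact I.smul_mem _ (I.add_mem hi (hI _ hi))
  have hksa : IsSelfAdjoint k := by
    rw [hk, isSelfAdjoint_iff, star_smul, star_add, star_star, add_comm]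
    simp
  have hsum : star x * x + k = (1 / 2 : ℝ) • ((star x * x + i) + star (star x * x + i)) := by
    rw [hk, star_add, star_mul, star_star]
    module
  have hnorm : ‖star x * x + k‖ ≤ c := by
    rw [hsum, norm_smul]
    have := norm_add_le (star x * x + i) (star (star x * x + i))
    rw [norm_star] at this
    rw [Real.norm_of_nonneg (by norm_num)]
    linarith
  have hle : star x * x + k ≤ algebraMap ℝ A c := by
    refine (IsSelfAdjoint.le_algebraMap_norm_self
      (((IsSelfAdjoint.star_mul_self x).add hksa))).trans ?_
    exact algebraMap_mono A hnorm
  set d : ℝ := c + ε with hd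
  have hd0 : 0 < d := by linarith
  -- The constant is chosen so that ε + h + k = (k + 2ε)²/(4ε) ≥ 0. Thus −k ≤ ε + h, where h is
  -- positive and in I, and x*x ≤ c − k ≤ d + h.
  set h : A := (1 / (4 * ε)) • (k * k) with hh
  have hh0 : 0 ≤ h := by
    have h1 : 0 ≤ k * k := by
      have := star_mul_self_nonneg k
      rwa [hksa.star_eq] at this
    exact smul_nonneg (by positivity) h1
  have hhI : h ∈ I := by
    rw [hh, ← Complex.coe_smul]
    exact I.smul_mem _ (I.mul_mem_left _ _ hkI)
  have hsq : 0 ≤ algebraMap ℝ A ε + h + k := by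
    have h1 : 0 ≤ (1 / (4 * ε)) • (star (k + algebraMap ℝ A (2 * ε)) *
        (k + algebraMap ℝ A (2 * ε))) :=
      smul_nonneg (by positivity) (star_mul_self_nonneg _)
    convert h1 using 1
    have : IsSelfAdjoint (k + algebraMap ℝ A (2 * ε)) :=
      hksa.add (IsSelfAdjoint.algebraMap A (by simp [IsSelfAdjoint]))
    rw [this.star_eq, hh]
    simp only [Algebra.algebraMap_eq_smul_one, mul_add, add_mul, smul_mul_assoc, mul_smul_comm,
      one_mul, mul_one, smul_add, smul_smul]
    have e1 : 1 / (4 * ε) * (2 * ε) = 1 / 2 := by field_simp; norm_num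
    have e2 : 1 / (4 * ε) * (2 * ε * (2 * ε)) = ε := by field_simp; norm_num
    simp only [e1, e2]
    module
  have hbound : star x * x ≤ d • (1 + (1 / d) • h) := by
    have h1 : star x * x ≤ algebraMap ℝ A c + (algebraMap ℝ A ε + h) := by
      have := add_le_add hle hsq
      rw [add_zero] at this
      have h2 := sub_le_sub_right this k
      convert h2 using 1 <;> abel
    convert h1 using 1
    rw [smul_add, smul_smul, mul_one_div_cancel hd0.ne', one_smul, hd,
      Algebra.algebraMap_eq_smul_one, Algebra.algebraMap_eq_smul_one]
    module
  -- With g = (1 + h/d)⁻¹, the element xg is congruent to x modulo I because 1 − g = (h/d)g, and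
  -- g(x*x)g ≤ d g(1 + h/d)g = d g has norm at most d.
  obtain ⟨g, hg, hg1, hgn, hgg⟩ :=
    exists_contraction_of_nonneg (h := (1 / d) • h) (smul_nonneg (by positivity) hh0)
  refine ⟨-(x * (1 - g)), I.neg_mem (I.mul_mem_left _ _ ?_), ?_⟩
  · rw [hg1, smul_mul_assoc, ← Complex.coe_smul]
    exact I.smul_mem _ (I.mul_mem_right _ _ hhI)
  · have e : x + -(x * (1 - g)) = x * g := by rw [mul_sub, mul_one]; abel
    have h1 : star (x * g) * (x * g) ≤ d • g := by
      have := star_left_conjugate_le_conjugate hbound g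
      rw [mul_smul_comm, smul_mul_assoc, hg.star_eq, hgg] at this
      rwa [star_mul, hg.star_eq, mul_assoc, ← mul_assoc (star x), ← mul_assoc]
    have h3 := CStarAlgebra.norm_le_norm_of_nonneg_of_le (star_mul_self_nonneg (x * g)) h1
    rw [CStarRing.norm_star_mul_self, norm_smul, Real.norm_of_nonneg hd0.le] at h3
    rw [e, sq]
    nlinarith

/-- The quotient norm of a self-adjoint two-sided ideal of a C*-algebra, as a C*-seminorm. -/
def TwoSidedIdeal.cstarSeminorm (I : TwoSidedIdeal A) (hI : ∀ x ∈ I, star x ∈ I) :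
    CStarSeminorm A :=
  have mul_le (a b : A) : ‖(Submodule.Quotient.mk (a * b) : A ⧸ I.asIdeal)‖ ≤
      ‖(Submodule.Quotient.mk a : A ⧸ I.asIdeal)‖ *
        ‖(Submodule.Quotient.mk b : A ⧸ I.asIdeal)‖ := by
    have key : ∀ ε > 0, ‖(Submodule.Quotient.mk (a * b) : A ⧸ I.asIdeal)‖ ≤
        (‖(Submodule.Quotient.mk a : A ⧸ I.asIdeal)‖ + ε) *
          (‖(Submodule.Quotient.mk b : A ⧸ I.asIdeal)‖ + ε) := fun ε hε => by
      obtain ⟨a', ha, ha'⟩ :=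
        Submodule.Quotient.norm_mk_lt (Submodule.Quotient.mk a : A ⧸ I.asIdeal) hε
      obtain ⟨b', hb, hb'⟩ :=
        Submodule.Quotient.norm_mk_lt (Submodule.Quotient.mk b : A ⧸ I.asIdeal) hε
      have e : (Submodule.Quotient.mk (a * b) : A ⧸ I.asIdeal) =
          Submodule.Quotient.mk (a' * b') := by
        rw [Submodule.Quotient.eq] at ha hb ⊢
        rw [show a * b - a' * b' = -((a' - a) * b + a' * (b' - b)) by noncomm_ring]
        exact I.neg_mem (I.add_mem (I.mul_mem_right _ _ ha) (I.mul_mem_left _ _ hb))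
      rw [e]
      refine (Submodule.Quotient.norm_mk_le _ _).trans ((norm_mul_le _ _).trans ?_)
      exact mul_le_mul ha'.le hb'.le (norm_nonneg _) ((norm_nonneg _).trans ha'.le)
    have hcont : Filter.Tendsto (fun ε : ℝ => (‖(Submodule.Quotient.mk a : A ⧸ I.asIdeal)‖ + ε) *
        (‖(Submodule.Quotient.mk b : A ⧸ I.asIdeal)‖ + ε)) (nhdsWithin 0 (Set.Ioi 0))
        (nhds ((‖(Submodule.Quotient.mk a : A ⧸ I.asIdeal)‖ + 0) *
          (‖(Submodule.Quotient.mk b : A ⧸ I.asIdeal)‖ + 0))) :=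
      tendsto_nhdsWithin_of_tendsto_nhds (Continuous.tendsto (by fun_prop) 0)
    rw [add_zero, add_zero] at hcont
    exact ge_of_tendsto hcont (Filter.eventually_of_mem self_mem_nhdsWithin key)
  have star_le (a : A) : ‖(Submodule.Quotient.mk (star a) : A ⧸ I.asIdeal)‖ ≤
      ‖(Submodule.Quotient.mk a : A ⧸ I.asIdeal)‖ := by
    refine le_of_forall_pos_le_add fun ε hε => ?_
    obtain ⟨a', ha, ha'⟩ :=
      Submodule.Quotient.norm_mk_lt (Submodule.Quotient.mk a : A ⧸ I.asIdeal) hε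
    have e : (Submodule.Quotient.mk (star a) : A ⧸ I.asIdeal) =
        Submodule.Quotient.mk (star a') := by
      rw [eq_comm, Submodule.Quotient.eq] at ha ⊢
      rw [← star_sub]
      exact hI _ ((I.neg_mem ha : _) |> fun h => by simpa using h)
    rw [e]
    refine (Submodule.Quotient.norm_mk_le _ _).trans ?_
    rw [norm_star]
    exact ha'.le
  { toFun a := ‖(Submodule.Quotient.mk a : A ⧸ I.asIdeal)‖
    map_zero' := by simp
    add_le' a b := by
      rw [Submodule.Quotient.mk_add]
      exact norm_add_le _ _
    neg' a := by rw [Submodule.Quotient.mk_neg, norm_neg]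
    mul_le' := mul_le
    smul' c a := by
      rw [Submodule.Quotient.mk_smul, norm_smul]
    cstar' a := by
      refine le_antisymm ?_ ?_
      · refine (mul_le _ _).trans ?_
        rw [sq]
        exact mul_le_mul_of_nonneg_right (star_le a) (norm_nonneg _)
      -- Half of ε pays for a representative b of the class of a*a with almost minimal norm, the
      -- other half for the correction j of a.
      · refine le_of_forall_pos_le_add fun ε hε => ?_
        obtain ⟨b, hb, hb'⟩ := Submodule.Quotient.norm_mk_lt
          (Submodule.Quotient.mk (star a * a) : A ⧸ I.asIdeal) (half_pos hε)
        have hi : b - star a * a ∈ I := (Submodule.Quotient.eq _).1 hb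
        obtain ⟨j, hj, hj'⟩ := exists_norm_add_sq_le I hI (x := a) hi (c := ‖b‖) (by simp)
          (half_pos hε)
        have e : (Submodule.Quotient.mk a : A ⧸ I.asIdeal) = Submodule.Quotient.mk (a + j) := by
          rw [eq_comm, Submodule.Quotient.eq, add_sub_cancel_left]
          exact hj
        have h1 : ‖(Submodule.Quotient.mk a : A ⧸ I.asIdeal)‖ ≤ ‖a + j‖ := by
          rw [e]
          exact Submodule.Quotient.norm_mk_le _ _
        have h2 := pow_le_pow_left₀ (norm_nonneg _) h1 2
        linarith }

theorem TwoSidedIdeal.cstarSeminorm_apply (I : TwoSidedIdeal A) (hI : ∀ x ∈ I, star x ∈ I)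
    (a : A) : I.cstarSeminorm hI a = ‖(Submodule.Quotient.mk a : A ⧸ I.asIdeal)‖ := rfl

end CStarQuotient

/-! ### Descent of C*-seminorms along surjections. -/

namespace CStarSeminorm

/-- A C*-seminorm which vanishes on the kernel of a surjective `*`-homomorphism descends along
it. -/
theorem exists_comap_eq {A B : Type*} [Ring A] [StarRing A] [Algebra ℂ A] [Ring B] [StarRing B]
    [Algebra ℂ B] {f : A →⋆ₐ[ℂ] B} (hf : Function.Surjective f) (q : CStarSeminorm A)
    (hq : ∀ a, f a = 0 → q a = 0) : ∃ q' : CStarSeminorm B, ∀ a, q' (f a) = q a := by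
  have le : ∀ a b, f a = f b → q a ≤ q b := fun a b h => by
    have h1 : q (a - b) = 0 := hq _ (by rw [map_sub, h, sub_self])
    have h2 := map_add_le_add q (a - b) b
    rwa [sub_add_cancel, h1, zero_add] at h2
  obtain ⟨F, hF⟩ : ∃ F : B → ℝ, ∀ a, F (f a) = q a :=
    ⟨fun b => q (Function.surjInv hf b), fun a =>
      le_antisymm (le _ _ (Function.surjInv_eq hf _)) (le _ _ (Function.surjInv_eq hf _).symm)⟩
  exact ⟨
    { toFun := F
      map_zero' := by rw [← map_zero f, hF, map_zero]
      add_le' := hf.forall₂.2 fun a b => by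
        rw [← map_add, hF, hF, hF]
        exact map_add_le_add q a b
      neg' := hf.forall.2 fun a => by rw [← map_neg, hF, hF, map_neg_eq_map]
      mul_le' := hf.forall₂.2 fun a b => by
        rw [← map_mul, hF, hF, hF]
        exact map_mul_le_mul q a b
      smul' := fun c => hf.forall.2 fun a => by rw [← _root_.map_smul f, hF, hF, q.map_smul]
      cstar' := hf.forall.2 fun a => by
        rw [← map_star, ← map_mul, hF, hF, q.map_star_mul_self] }, hF⟩

end CStarSeminorm

/-! ### Functoriality and exactness of the enveloping C*-algebra. -/

namespace CStarEnvelope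

variable {A B C : Type*} [Ring A] [StarRing A] [Algebra ℂ A] [HasCStarEnvelope A]
  [Ring B] [StarRing B] [Algebra ℂ B] [HasCStarEnvelope B]
  [Ring C] [StarRing C] [Algebra ℂ C] [HasCStarEnvelope C]

theorem map_id : map (StarAlgHom.id ℂ A) = StarAlgHom.id ℂ (CStarEnvelope A) :=
  StarAlgHom.ext fun x => denseRange_of.induction_on x
    (isClosed_eq (continuous_map _) continuous_id) fun a => by simp

theorem map_comp (g : B →⋆ₐ[ℂ] C) (f : A →⋆ₐ[ℂ] B) : map (g.comp f) = (map g).comp (map f) :=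
  StarAlgHom.ext fun x => denseRange_of.induction_on x
    (isClosed_eq (continuous_map _) ((continuous_map g).comp (continuous_map f))) fun a => by simp

section

variable [StarModule ℂ A] {f : A →⋆ₐ[ℂ] B}

/-- The quotient norm of I, pulled back to A, is a C*-seminorm vanishing on the kernel of f. It
therefore descends to B, where the largest C*-seminorm dominates it; density of A extends the
estimate to the completion. -/
theorem norm_mk_le_norm_map (hf : Function.Surjective f) (I : TwoSidedIdeal (CStarEnvelope A))
    (hI : ∀ x ∈ I, star x ∈ I) (hker : ∀ a, f a = 0 → of a ∈ I) (x : CStarEnvelope A) :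
    ‖(Submodule.Quotient.mk x : CStarEnvelope A ⧸ I.asIdeal)‖ ≤ ‖map f x‖ := by
  let ofStar : A →⋆ₐ[ℂ] CStarEnvelope A := { of with map_star' := fun a => (star_of a).symm }
  obtain ⟨q, hq⟩ := ((I.cstarSeminorm hI).comap ofStar).exists_comap_eq hf fun a ha => by
    rw [CStarSeminorm.comap_apply, TwoSidedIdeal.cstarSeminorm_apply]
    change ‖(Submodule.Quotient.mk (of a) : CStarEnvelope A ⧸ I.asIdeal)‖ = 0
    rw [(Submodule.Quotient.mk_eq_zero I.asIdeal).2 (hker a ha), norm_zero]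
  refine denseRange_of.induction_on (p := fun x =>
    ‖(Submodule.Quotient.mk x : CStarEnvelope A ⧸ I.asIdeal)‖ ≤ ‖map f x‖) x
    (isClosed_le ?_ (continuous_map f).norm) fun a => ?_
  · exact continuous_norm.comp continuous_quotient_mk'
  · rw [map_of, norm_of]
    refine le_trans (le_of_eq ?_) (le_maxCStarSeminorm q (f a))
    rw [hq]
    rfl

theorem mem_of_map_eq_zero (hf : Function.Surjective f) (I : TwoSidedIdeal (CStarEnvelope A))
    (hI : ∀ x ∈ I, star x ∈ I) (hclosed : IsClosed (I : Set (CStarEnvelope A)))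
    (hker : ∀ a, f a = 0 → of a ∈ I) {x : CStarEnvelope A} (hx : map f x = 0) : x ∈ I := by
  have h := norm_mk_le_norm_map hf I hI hker x
  rw [hx, norm_zero] at h
  have h' := (QuotientAddGroup.norm_mk_eq_zero_iff_mem_closure
    (S := I.asIdeal.toAddSubgroup)).1 (le_antisymm h (norm_nonneg _))
  have e : (I.asIdeal.toAddSubgroup : Set (CStarEnvelope A)) = I := rfl
  rwa [e, hclosed.closure_eq] at h'

/-- The map induced on enveloping C*-algebras by a surjective `*`-homomorphism is surjective. -/
theorem map_surjective (hf : Function.Surjective f) : Function.Surjective (map f) := by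
  have hclosed : IsClosed (TwoSidedIdeal.ker (map f) : Set (CStarEnvelope A)) := by
    have : (TwoSidedIdeal.ker (map f) : Set (CStarEnvelope A)) = map f ⁻¹' {0} := by
      ext x
      exact TwoSidedIdeal.mem_ker _
    rw [this]
    exact isClosed_singleton.preimage (continuous_map f)
  have hstar : ∀ x ∈ TwoSidedIdeal.ker (map f), star x ∈ TwoSidedIdeal.ker (map f) := by
    intro x hx
    rw [TwoSidedIdeal.mem_ker] at hx ⊢
    rw [map_star, hx, star_zero]
  have hbound : ∀ x, ‖map f x‖ ≤ 1 * ‖x‖ := fun x => by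
    rw [one_mul]
    refine denseRange_of.induction_on (p := fun x => ‖map f x‖ ≤ ‖x‖) x
      (isClosed_le (continuous_map f).norm continuous_norm) fun a => ?_
    rw [map_of]
    exact norm_of_map_le f a
  let F : NormedAddGroupHom (CStarEnvelope A) (CStarEnvelope B) :=
    { toFun := map f
      map_add' := map_add _
      bound' := ⟨1, hbound⟩ }
  -- The class of x modulo the kernel has norm at most ‖F x‖, and a representative may exceed this
  -- by ‖F x‖, hence the factor 2. By completeness, controlled preimages exist for the whole closure
  -- of the range, which is everything by density.
  have hF : F.SurjectiveOnWith F.range 2 := by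
    rintro _ ⟨x, rfl⟩
    by_cases h0 : F x = 0
    · exact ⟨0, by simp [h0]⟩
    have hpos : 0 < ‖F x‖ := norm_pos_iff.2 h0
    obtain ⟨y, hy, hy'⟩ := Submodule.Quotient.norm_mk_lt
      (Submodule.Quotient.mk x : CStarEnvelope A ⧸ (TwoSidedIdeal.ker (map f)).asIdeal) hpos
    refine ⟨y, ?_, ?_⟩
    · have h1 : y - x ∈ TwoSidedIdeal.ker (map f) := (Submodule.Quotient.eq _).1 hy
      rw [TwoSidedIdeal.mem_ker, map_sub, sub_eq_zero] at h1
      exact h1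
    · have h2 : ‖(Submodule.Quotient.mk x :
          CStarEnvelope A ⧸ (TwoSidedIdeal.ker (map f)).asIdeal)‖ ≤ ‖F x‖ :=
        norm_mk_le_norm_map hf _ hstar
          (fun a ha => (TwoSidedIdeal.mem_ker _).2 (by rw [map_of, ha, _root_.map_zero])) x
      rw [two_mul]
      exact hy'.le.trans (add_le_add_left h2 _)
  have hF' := controlled_closure_of_complete two_pos one_pos hF
  intro y
  obtain ⟨x, hx, -⟩ := hF' y (by
    rw [← SetLike.mem_coe, AddSubgroup.topologicalClosure_coe]
    refine closure_mono ?_ (denseRange_of y)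
    rintro _ ⟨b, rfl⟩
    obtain ⟨a, rfl⟩ := hf b
    exact ⟨of a, map_of f a⟩)
  exact ⟨x, hx⟩

end

end CStarEnvelope

/-! ## Quotients by two-sided ideals -/

/-- The involution on the quotient by a self-adjoint two-sided ideal. -/
abbrev TwoSidedIdeal.quotientStarRing {R : Type*} [Ring R] [StarRing R] (I : TwoSidedIdeal R)
    (hI : ∀ x ∈ I, star x ∈ I) : StarRing I.ringCon.Quotient where
  star := Quotient.map' star fun a b h => by
    have h' : a - b ∈ I := (I.rel_iff a b).1 h
    exact (I.rel_iff _ _).2 (by rw [← star_sub]; exact hI _ h')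
  star_involutive := by
    rintro ⟨a⟩
    exact congrArg I.ringCon.mk' (star_star a)
  star_mul := by
    rintro ⟨a⟩ ⟨b⟩
    exact congrArg I.ringCon.mk' (star_mul a b)
  star_add := by
    rintro ⟨a⟩ ⟨b⟩
    exact congrArg I.ringCon.mk' (star_add a b)

theorem TwoSidedIdeal.mk'_eq_zero {R : Type*} [Ring R] (I : TwoSidedIdeal R) {a : R} :
    I.ringCon.mk' a = 0 ↔ a ∈ I := by
  rw [← TwoSidedIdeal.mem_ker, TwoSidedIdeal.ker_ringCon_mk']

/-- The first isomorphism theorem for a surjective `*`-homomorphism. -/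
theorem StarAlgHom.exists_quotient_equiv {K A B : Type*} [Field K] [Ring A] [StarRing A]
    [Algebra K A] [Ring B] [StarRing B] [Algebra K B] (f : A →⋆ₐ[K] B)
    (hf : Function.Surjective f) (I : TwoSidedIdeal A) (hI : TwoSidedIdeal.ker f = I) :
    ∃ ψ : I.ringCon.Quotient ≃ₐ[K] B, (∀ a, ψ (I.ringCon.mk' a) = f a) ∧
      ∀ a, ψ (I.ringCon.mk' (star a)) = star (ψ (I.ringCon.mk' a)) := by
  have hker : ∀ a b, I.ringCon a b ↔ f a = f b := fun a b => by
    rw [I.rel_iff, ← hI, TwoSidedIdeal.mem_ker, map_sub, sub_eq_zero]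
  let F : I.ringCon.Quotient →+* B := I.ringCon.lift (f : A →+* B) fun a b h => (hker a b).1 h
  let F' : I.ringCon.Quotient →ₐ[K] B :=
    { F with commutes' := fun c => AlgHomClass.commutes f c }
  have hF : ∀ a, F' (I.ringCon.mk' a) = f a := fun a => rfl
  have hbij : Function.Bijective F' := by
    constructor
    · intro x y
      obtain ⟨a, rfl⟩ := I.ringCon.mk'_surjective x
      obtain ⟨b, rfl⟩ := I.ringCon.mk'_surjective y
      rw [hF, hF]
      exact fun h => (RingCon.eq _).2 ((hker a b).2 h)
    · intro y
      obtain ⟨a, rfl⟩ := hf y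
      exact ⟨I.ringCon.mk' a, hF a⟩
  refine ⟨AlgEquiv.ofBijective F' hbij, hF, fun a => ?_⟩
  exact (hF _).trans ((map_star f a).trans (congrArg star (hF a).symm))

end

noncomputable section

/-! ## Products of commuting partitions of an idempotent -/

section Choice

variable {ι : Type*} [Fintype ι] [Nonempty ι] {α : ι → Type*} [∀ i, Fintype (α i)]

-- V c is the product of the e i (c i). Expanding the product over i of the sums ∑ a, e i a gives a
-- power of P, which is P because P is idempotent and ι is nonempty.
open scoped Classical in
theorem exists_choice_idempotents_of_commRing {R : Type*} [CommRing R] (e : ∀ i, α i → R) (P : R)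
    (orth : ∀ i a b, e i a * e i b = if a = b then e i a else 0) (hsum : ∀ i, ∑ a, e i a = P) :
    ∃ V : (∀ i, α i) → R, ∑ c, V c = P ∧
      ∀ i a c, e i a * V c = if c i = a then V c else 0 := by
  refine ⟨fun c => ∏ i, e i (c i), ?_, fun i a c => ?_⟩
  rotate_left
  · simp only
    rw [← Finset.mul_prod_erase _ _ (Finset.mem_univ i), ← mul_assoc, orth]
    by_cases h : c i = a
    · rw [if_pos h.symm, if_pos h, h]
    · rw [if_neg (Ne.symm h), if_neg h, zero_mul]
  · have hP : IsIdempotentElem P := by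
      obtain ⟨i⟩ := ‹Nonempty ι›
      rw [IsIdempotentElem, ← hsum i, Finset.sum_mul_sum]
      simp [orth]
    have h := Finset.prod_univ_sum (fun i => (Finset.univ : Finset (α i))) e
    simp only [hsum, Finset.prod_const, Finset.card_univ, Fintype.piFinset_univ] at h
    rw [← h]
    exact hP.pow_eq Fintype.card_ne_zero

-- The subring generated by the e i a is commutative, so the commutative case applies inside it; the
-- V c found there commute with every e i a.
open scoped Classical IsMulCommutative in
theorem exists_choice_idempotents {R : Type*} [Ring R] (e : ∀ i, α i → R) (P : R)
    (hcomm : ∀ i a j b, e i a * e j b = e j b * e i a)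
    (orth : ∀ i a b, e i a * e i b = if a = b then e i a else 0) (hsum : ∀ i, ∑ a, e i a = P) :
    ∃ V : (∀ i, α i) → R, ∑ c, V c = P ∧
      (∀ i a c, e i a * V c = if c i = a then V c else 0) ∧
      ∀ i a c, Commute (e i a) (V c) := by
  let s : Set R := Set.range fun p : Σ i, α i => e p.1 p.2
  have : IsMulCommutative (Subring.closure s) := Subring.isMulCommutative_closure (by
    rintro _ ⟨p, rfl⟩ _ ⟨q, rfl⟩
    exact hcomm _ _ _ _)
  let e' : ∀ i, α i → Subring.closure s := fun i a => ⟨e i a, Subring.subset_closure ⟨⟨i, a⟩, rfl⟩⟩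
  have hP : P ∈ Subring.closure s := by
    obtain ⟨i⟩ := ‹Nonempty ι›
    rw [← hsum i]
    exact Subring.sum_mem _ fun a _ => (e' i a).2
  obtain ⟨V, hV, hV'⟩ := exists_choice_idempotents_of_commRing e' ⟨P, hP⟩
    (fun i a b => Subtype.ext (by
      rw [Subring.coe_mul, apply_ite Subtype.val]
      exact orth i a b))
    (fun i => Subtype.ext (by
      rw [AddSubmonoidClass.coe_finsetSum]
      exact hsum i))
  refine ⟨fun c => V c, ?_, fun i a c => ?_, fun i a c => ?_⟩
  · rw [← AddSubmonoidClass.coe_finsetSum, hV]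
  · have h := congrArg Subtype.val (hV' i a c)
    rwa [Subring.coe_mul, apply_ite Subtype.val] at h
  · exact congrArg Subtype.val (mul_comm (e' i a) (V c))

end Choice

namespace BipartiteSepGraph

/-! ## Families in quotients by commutators -/

section Family

variable {G : BipartiteSepGraph.{u}} {A : Type*} [Ring A] [StarRing A] {P : G.Vertex → A}
  {S : G.Edge → A}

theorem IsFamily.map {B : Type*} [Ring B] [StarRing B] (h : IsFamily P S) (f : A →+* B)
    (hf : ∀ a, f (star a) = star (f a)) : IsFamily (fun p => f (P p)) fun e => f (S e) where
  vertex_mul p q := by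
    rw [← map_mul, h.vertex_mul, apply_ite f, map_zero]
  vertex_star p := by rw [← hf, ← h.vertex_star]
  range_mul e := by rw [← map_mul, h.range_mul]
  mul_source e := by rw [← map_mul, h.mul_source]
  sck1 e e' he := by rw [← hf, ← map_mul, h.sck1 e e' he, apply_ite f, map_zero]
  sck2 X := by
    rw [h.sck2, map_sum]
    exact Finset.sum_congr rfl fun e _ => by rw [map_mul, hf]
  one := by rw [← map_sum, ← h.one, map_one]

theorem IsFamily.star_mul_range (h : IsFamily P S) (e : G.Edge) :
    star (S e) * P (Sum.inl (G.range e)) = star (S e) := by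
  have := congrArg star (h.range_mul e)
  rwa [star_mul, ← h.vertex_star] at this

theorem IsFamily.source_mul_star (h : IsFamily P S) (e : G.Edge) :
    P (Sum.inr (G.source e)) * star (S e) = star (S e) := by
  have := congrArg star (h.mul_source e)
  rwa [star_mul, ← h.vertex_star] at this

theorem IsFamily.mul_star_mul_self (h : IsFamily P S) (e : G.Edge) :
    S e * star (S e) * S e = S e := by
  rw [mul_assoc, h.sck1 e e rfl, if_pos rfl, h.mul_source]

/-- The edge of `E_n` which an arrow of `E_{n+1}` comes from. -/
def prev (G : BipartiteSepGraph.{u}) (a : G.next.Edge) : G.Edge := G.next.block a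

theorem root_source_eq (G : BipartiteSepGraph.{u}) (a : G.next.Edge) :
    G.root (G.next.source a) = G.range (G.prev a) :=
  G.root_source a

theorem eq_of_source_eq (G : BipartiteSepGraph.{u}) {a b : G.next.Edge}
    (hs : G.next.source a = G.next.source b) (hb : G.block (G.prev a) = G.block (G.prev b)) :
    a = b :=
  G.next_edge_ext hs hb

/-- The values on the vertices of `E_{n+1}` given by those on `E_n^{0,1}` and on the new
vertices. -/
def nextVertex {B : Type*} (P : G.Vertex → B) (V : G.next.V1 → B) : G.next.Vertex → B :=
  Sum.elim (fun w : G.V1 => P (Sum.inr w)) V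

theorem nextVertex_inl {B : Type*} (P : G.Vertex → B) (V : G.next.V1 → B) (w : G.next.V0) :
    nextVertex P V (Sum.inl w) = P (Sum.inr (show G.V1 from w)) := rfl

theorem nextVertex_inr {B : Type*} (P : G.Vertex → B) (V : G.next.V1 → B) (q : G.next.V1) :
    nextVertex P V (Sum.inr q) = V q := rfl

/-- The new vertex v(x_1, …, x_k) is recovered from the edges x_i: as C_u is nonempty there is at
least one of them, its range is u, and then each x_i is identified by its block. -/
theorem next_vertex_ext (G : BipartiteSepGraph.{u}) {q q' : G.next.V1}
    (h : ∀ a, G.next.source a = q → ∃ a', G.next.source a' = q' ∧ G.prev a' = G.prev a) :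
    q = q' := by
  have hroot : G.root q = G.root q' := by
    obtain ⟨X, hX⟩ := G.base_surjective (G.root q)
    obtain ⟨a, rfl, -⟩ := G.exists_next_edge q X hX
    obtain ⟨a', rfl, ha⟩ := h a rfl
    rw [root_source_eq, root_source_eq, ha]
  obtain ⟨u, c⟩ := q
  obtain ⟨u', c'⟩ := q'
  obtain rfl : u = u' := hroot
  congr 1
  funext X
  obtain ⟨a', ha', hb⟩ := h (⟨⟨u, c⟩, X⟩ : G.NewEdge) rfl
  obtain ⟨q, Y⟩ := a'
  obtain rfl : q = ⟨u, c'⟩ := ha'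
  have h1 : (c' Y).1 = (c X).1 := hb
  have h2 : Y.1 = X.1 := by rw [← (c' Y).2, ← (c X).2, h1]
  obtain rfl : Y = X := Subtype.ext h2
  exact Subtype.ext h1.symm

variable (P S) in
open scoped Classical in
/-- Elements indexed by the new vertices of the multiresolution which behave as the products
`(x_1 x_1^*) ⋯ (x_k x_k^*)`, for the new vertex `v(x_1, …, x_k)`. -/
structure IsRefinement (V : G.next.V1 → A) : Prop where
  sum : ∀ u, ∑ q with G.root q = u, V q = P (Sum.inl u)
  parent_mul : ∀ a, S (G.prev a) * star (S (G.prev a)) * V (G.next.source a) =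
    V (G.next.source a)
  mul_eq_zero : ∀ x q, (∀ a, G.next.source a = q → G.prev a ≠ x) →
    S x * star (S x) * V q = 0
  commute : ∀ x q, Commute (S x * star (S x)) (V q)

/-- At each u the blocks of C_u give partitions of u into range projections, which commute with each
other by hypothesis, so the product construction applies. Range projections of edges with another
range annihilate the result on both sides, since distinct vertices are orthogonal. -/
theorem IsFamily.exists_isRefinement (h : IsFamily P S)
    (hc : ∀ x y, Commute (S x * star (S x)) (S y * star (S y))) :
    ∃ V : G.next.V1 → A, IsRefinement P S V := by
  classical
  have key : ∀ u : G.V0, ∃ V : G.Choice u → A, ∑ c, V c = P (Sum.inl u) ∧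
      (∀ X (a : {e : G.Edge // G.block e = X.1}) c,
        S a * star (S a) * V c = if c X = a then V c else 0) ∧
      ∀ (X : {X : G.Block // G.base X = u}) (a : {e : G.Edge // G.block e = X.1}) c,
        Commute (S a * star (S a)) (V c) := by
    intro u
    have : Nonempty {X : G.Block // G.base X = u} := by
      obtain ⟨X, hX⟩ := G.base_surjective u
      exact ⟨X, hX⟩
    have := exists_choice_idempotents (ι := {X : G.Block // G.base X = u})
      (α := fun X => {e : G.Edge // G.block e = X.1})
      (fun _ a => S a * star (S a)) (P (Sum.inl u)) (fun _ a _ b => hc a b) (fun X a b => ?_)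
      fun X => ?_
    · convert this
    · rw [mul_assoc, ← mul_assoc (star _), h.sck1 _ _ (a.2.trans b.2.symm)]
      by_cases hab : a = b
      · subst hab
        rw [if_pos rfl, if_pos rfl, h.source_mul_star]
      · rw [if_neg hab, if_neg fun h' => hab (Subtype.ext h'), zero_mul, mul_zero]
    · obtain ⟨X, rfl⟩ := X
      rw [h.sck2 X]
      exact (Finset.sum_subtype _ (by simp) fun e => S e * star (S e)).symm
  choose V hsum hmul hcomm using key
  let W : G.next.V1 → A := fun q => V (G.root q) (Sigma.snd (β := G.Choice) q)
  have hroot_mul : ∀ q, P (Sum.inl (G.root q)) * W q = W q := by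
    rintro ⟨u, c⟩
    obtain ⟨X, hX⟩ := G.base_surjective u
    have h1 := hmul u ⟨X, hX⟩ (c ⟨X, hX⟩) c
    rw [if_pos rfl] at h1
    have h2 : G.range (c ⟨X, hX⟩).1 = u := by
      rw [range, (c ⟨X, hX⟩).2, hX]
    change P (Sum.inl u) * V u c = V u c
    rw [← h1]
    have h3 := h.range_mul (c ⟨X, hX⟩).1
    rw [h2] at h3
    rw [← mul_assoc, ← mul_assoc, h3]
  have hmul_root : ∀ q, W q * P (Sum.inl (G.root q)) = W q := by
    rintro ⟨u, c⟩
    obtain ⟨X, hX⟩ := G.base_surjective u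
    have h1 := hmul u ⟨X, hX⟩ (c ⟨X, hX⟩) c
    rw [if_pos rfl, (hcomm u ⟨X, hX⟩ (c ⟨X, hX⟩) c).eq] at h1
    have h2 : G.range (c ⟨X, hX⟩).1 = u := by
      rw [range, (c ⟨X, hX⟩).2, hX]
    change V u c * P (Sum.inl u) = V u c
    rw [← h1]
    have h3 := h.star_mul_range (c ⟨X, hX⟩).1
    rw [h2] at h3
    rw [mul_assoc, mul_assoc, h3]
  have hzero : ∀ x q, G.range x ≠ G.root q → S x * star (S x) * W q = 0 := fun x q hx => by
    rw [← hroot_mul q, ← h.star_mul_range x, mul_assoc, mul_assoc, ← mul_assoc (P _) (P _),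
      h.vertex_mul, if_neg (by simpa using hx), zero_mul, mul_zero, mul_zero]
  have hzero' : ∀ x q, G.range x ≠ G.root q → W q * (S x * star (S x)) = 0 := fun x q hx => by
    rw [← hmul_root q, ← h.range_mul x, mul_assoc, mul_assoc, ← mul_assoc (P _) (P _),
      h.vertex_mul, if_neg (by simpa using hx.symm), zero_mul, mul_zero]
  refine ⟨W, ⟨fun u => ?_, ?_, ?_, ?_⟩⟩
  · rw [← hsum u]
    symm
    refine Finset.sum_bij (fun c _ => (⟨u, c⟩ : G.NewVertex)) ?_ ?_ ?_ ?_
    · intro c _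
      exact Finset.mem_filter.2 ⟨Finset.mem_univ _, rfl⟩
    · intro c _ c' _ hcc
      exact eq_of_heq (Sigma.mk.inj hcc).2
    · rintro ⟨u', c⟩ hq
      obtain rfl : u' = u := (Finset.mem_filter.1 hq).2
      exact ⟨c, Finset.mem_univ _, rfl⟩
    · intro c _
      rfl
  · rintro ⟨⟨u, c⟩, X⟩
    exact (hmul u X (c X) c).trans (if_pos rfl)
  · rintro x ⟨u, c⟩ hx
    by_cases hu : G.range x = u
    · refine (hmul u ⟨G.block x, hu⟩ ⟨x, rfl⟩ c).trans (if_neg fun h' => ?_)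
      exact hx (⟨⟨u, c⟩, ⟨G.block x, hu⟩⟩ : G.NewEdge) rfl (congrArg Subtype.val h')
    · exact hzero x ⟨u, c⟩ hu
  · rintro x ⟨u, c⟩
    by_cases hu : G.range x = u
    · exact hcomm u ⟨G.block x, hu⟩ ⟨x, rfl⟩ c
    · exact (hzero x ⟨u, c⟩ hu).trans (hzero' x ⟨u, c⟩ hu).symm

/-! ### A refinement consists of orthogonal projections and yields a family for the next graph. -/

namespace IsRefinement

variable {V : G.next.V1 → A}

theorem root_mul (hV : IsRefinement P S V) (h : IsFamily P S) (q : G.next.V1) :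
    P (Sum.inl (G.root q)) * V q = V q := by
  obtain ⟨X, hX⟩ := G.base_surjective (G.root q)
  obtain ⟨a, rfl, -⟩ := G.exists_next_edge q X hX
  rw [← hV.parent_mul a, root_source_eq, ← mul_assoc, ← mul_assoc, h.range_mul]

theorem mul_root (hV : IsRefinement P S V) (h : IsFamily P S) (q : G.next.V1) :
    V q * P (Sum.inl (G.root q)) = V q := by
  obtain ⟨X, hX⟩ := G.base_surjective (G.root q)
  obtain ⟨a, rfl, -⟩ := G.exists_next_edge q X hX
  rw [← hV.parent_mul a, (hV.commute _ _).eq, root_source_eq, mul_assoc, mul_assoc, h.star_mul_range]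

theorem exists_of_ne {q q' : G.next.V1} (hq : q ≠ q') : ∃ a, G.next.source a = q ∧
    ∀ a', G.next.source a' = q' → G.prev a' ≠ G.prev a := by
  by_contra! h
  exact hq (G.next_vertex_ext h)

/-- Some x belongs to the family of q but not to that of q'; then xx* is absorbed by V q and
annihilates V q'. -/
theorem mul_of_ne (hV : IsRefinement P S V) {q q' : G.next.V1} (hq : q ≠ q') :
    V q * V q' = 0 := by
  obtain ⟨a, rfl, ha⟩ := exists_of_ne hq
  rw [← hV.parent_mul a, (hV.commute _ _).eq, mul_assoc, hV.mul_eq_zero _ _ ha, mul_zero]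

theorem star_mul_of_ne (hV : IsRefinement P S V) {q q' : G.next.V1} (hq : q ≠ q') :
    star (V q) * V q' = 0 := by
  obtain ⟨a, rfl, ha⟩ := exists_of_ne hq
  rw [← hV.parent_mul a, star_mul, star_mul, star_star, mul_assoc, hV.mul_eq_zero _ _ ha, mul_zero]

/-- Multiply V q by its root, written as the sum of the V q' over the new vertices with that root:
only the term q' = q survives. -/
theorem mul_self (hV : IsRefinement P S V) (h : IsFamily P S) (q : G.next.V1) :
    V q * V q = V q := by
  classical
  have h1 := hV.mul_root h q
  rwa [← hV.sum, Finset.mul_sum, Finset.sum_eq_single q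
    (fun q' _ hq => hV.mul_of_ne hq.symm) (fun hq => absurd (by simp) hq)] at h1

/-- Expanding the root in star (V q) * P(root) in the same way gives star (V q) = star (V q) * V q,
and the right-hand side is self-adjoint. -/
theorem star_eq (hV : IsRefinement P S V) (h : IsFamily P S) (q : G.next.V1) :
    star (V q) = V q := by
  classical
  have h1 := congrArg star (hV.root_mul h q)
  rw [star_mul, ← h.vertex_star, ← hV.sum, Finset.mul_sum, Finset.sum_eq_single q
    (fun q' _ hq => hV.star_mul_of_ne hq.symm) (fun hq => absurd (by simp) hq)] at h1
  have h2 := congrArg star h1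
  rw [star_mul, star_star, h1] at h2
  exact h2

-- Write xx* as xx* times its range vertex and expand that vertex: xx* fixes V q when x is in the
-- family of q and kills it otherwise. Arrows with the same parent have distinct sources, so no V q
-- is counted twice.
open scoped Classical in
theorem sum_source (hV : IsRefinement P S V) (h : IsFamily P S) (x : G.Edge) :
    ∑ a : G.next.Edge with G.prev a = x, V (G.next.source a) = S x * star (S x) := by
  have h1 : S x * star (S x) = ∑ q with G.root q = G.range x, S x * star (S x) * V q := by
    rw [← Finset.mul_sum, hV.sum, mul_assoc, h.star_mul_range]
  rw [h1]
  have inj : Set.InjOn G.next.source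
      ((Finset.univ.filter fun a : G.next.Edge => G.prev a = x : Finset _) :
        Set G.next.Edge) := by
    intro a ha b hb hab
    simp only [Finset.coe_filter, Finset.mem_univ, true_and] at ha hb
    exact G.eq_of_source_eq hab (by rw [ha, hb])
  rw [← Finset.sum_image (f := V) inj]
  have hsub : (Finset.univ.filter fun a : G.next.Edge => G.prev a = x).image G.next.source ⊆
      Finset.univ.filter fun q => G.root q = G.range x := by
    intro q hq
    obtain ⟨a, ha, rfl⟩ := Finset.mem_image.1 hq
    refine Finset.mem_filter.2 ⟨Finset.mem_univ _, ?_⟩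
    rw [root_source_eq, (Finset.mem_filter.1 ha).2]
  rw [← Finset.sum_subset hsub]
  · refine Finset.sum_congr rfl fun q hq => ?_
    obtain ⟨a, ha, rfl⟩ := Finset.mem_image.1 hq
    obtain rfl : G.prev a = x := (Finset.mem_filter.1 ha).2
    exact (hV.parent_mul a).symm
  · intro q _ hq
    refine hV.mul_eq_zero x q fun a ha hax => hq ?_
    exact Finset.mem_image.2 ⟨a, Finset.mem_filter.2 ⟨Finset.mem_univ _, hax⟩, ha⟩

/-- The family of the multiresolution obtained from a refinement. -/
theorem isFamily_next (hV : IsRefinement P S V) (h : IsFamily P S) :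
    IsFamily (G := G.next) (nextVertex P V)
      fun a => star (S (G.prev a)) * V (G.next.source a) := by
  classical
  have starT : ∀ a : G.next.Edge, star (star (S (G.prev a)) * V (G.next.source a)) =
      V (G.next.source a) * S (G.prev a) := fun a => by
    rw [star_mul, star_star, hV.star_eq h]
  have hPV : ∀ w q, P (Sum.inr w) * V q = 0 := fun w q => by
    rw [← hV.root_mul h q, ← mul_assoc, h.vertex_mul, if_neg Sum.inr_ne_inl, zero_mul]
  have hVP : ∀ w q, V q * P (Sum.inr w) = 0 := fun w q => by
    rw [← hV.mul_root h q, mul_assoc, h.vertex_mul, if_neg Sum.inl_ne_inr, mul_zero]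
  refine ⟨?_, ?_, ?_, ?_, ?_, ?_, ?_⟩
  · rintro (w | q) (w' | q')
    · simp only [nextVertex_inl]
      rw [h.vertex_mul]
      by_cases hw : w = w'
      · subst hw
        rw [if_pos rfl, if_pos rfl]
      · exact (if_neg fun h' => hw (Sum.inr_injective h')).trans
          (if_neg fun h' => hw (Sum.inl_injective h')).symm
    · exact (hPV w q').trans (if_neg Sum.inl_ne_inr).symm
    · exact (hVP w' q).trans (if_neg Sum.inr_ne_inl).symm
    · simp only [nextVertex_inr]
      by_cases hq : q = q'
      · subst hq
        rw [if_pos rfl, hV.mul_self h]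
      · rw [if_neg fun h' => hq (Sum.inr_injective h'), hV.mul_of_ne hq]
  · rintro (w | q)
    · exact h.vertex_star _
    · exact (hV.star_eq h q).symm
  · intro a
    simp only [nextVertex_inl]
    rw [← mul_assoc]
    congr 1
    exact h.source_mul_star (G.prev a)
  · intro a
    simp only [nextVertex_inr]
    rw [mul_assoc, hV.mul_self h]
  · intro a b hab
    replace hab : G.prev a = G.prev b := hab
    simp only [nextVertex_inr]
    rw [starT, mul_assoc, ← mul_assoc (S _), hab, hV.parent_mul b]
    by_cases hs : a = b
    · subst hs
      rw [if_pos rfl, hV.mul_self h]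
    · rw [if_neg hs]
      refine hV.mul_of_ne fun hs' => hs (G.eq_of_source_eq hs' ?_)
      exact congrArg G.block hab
  · intro (x : G.Edge)
    -- Writing s(x) as x*(xx*)x lets the middle factor be expanded over the arrows a coming from x;
    -- each x* V x is then (x* V)(x* V)*.
    have e : P (Sum.inr (G.source x)) = star (S x) * (S x * star (S x)) * S x := by
      rw [mul_assoc, h.mul_star_mul_self, h.sck1 x x rfl, if_pos rfl]
    change P (Sum.inr (G.source x)) = ∑ a : G.next.Edge with G.prev a = x, _
    rw [e, ← hV.sum_source h x, Finset.mul_sum, Finset.sum_mul]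
    refine Finset.sum_congr rfl fun a ha => ?_
    obtain rfl : G.prev a = x := (Finset.mem_filter.1 ha).2
    rw [starT, mul_assoc, mul_assoc, ← mul_assoc (V _) (V _), hV.mul_self h]
  · rw [h.one, Fintype.sum_sum_type, Fintype.sum_sum_type, add_comm]
    congr 1
    simp only [nextVertex_inr, ← hV.sum]
    exact Finset.sum_fiberwise _ _ _

end IsRefinement

end Family

/-! ### Induction and extensionality for Leavitt algebras. -/

namespace Leavitt

variable {K : Type v} [Field K] [StarRing K] {G : BipartiteSepGraph.{u}}

theorem induction {p : Leavitt K G → Prop} (alg : ∀ r, p (algebraMap K _ r))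
    (vertex : ∀ q, p (vertex K q)) (edge : ∀ e, p (edge K e)) (star : ∀ a, p a → p (star a))
    (mul : ∀ a b, p a → p b → p (a * b)) (add : ∀ a b, p a → p b → p (a + b))
    (a : Leavitt K G) : p a := by
  obtain ⟨a, rfl⟩ := mk_surjective a
  have hgen : ∀ x, p (mk K G (FreeStarAlgebra.gen K x)) := by
    rintro (q | e)
    · exact vertex q
    · exact edge e
  induction a using FreeStarAlgebra.induction with
  | alg r =>
    rw [AlgHom.commutes]
    exact alg r
  | gen x => exact hgen x
  | genStar x =>
    rw [← FreeStarAlgebra.star_gen, mk_star]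
    exact star _ (hgen x)
  | mul a b ha hb =>
    rw [map_mul]
    exact mul _ _ ha hb
  | add a b ha hb =>
    rw [map_add]
    exact add _ _ ha hb

theorem hom_ext {A : Type*} [Ring A] [StarRing A] [Algebra K A] {f g : Leavitt K G →⋆ₐ[K] A}
    (hv : ∀ p, f (vertex K p) = g (vertex K p)) (he : ∀ e, f (edge K e) = g (edge K e)) :
    f = g := by
  refine StarAlgHom.ext fun a => ?_
  induction a using induction with
  | alg r => rw [AlgHomClass.commutes, AlgHomClass.commutes]
  | vertex p => exact hv p
  | edge e => exact he e
  | star a ha => rw [map_star, map_star, ha]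
  | mul a b ha hb => rw [map_mul, map_mul, ha, hb]
  | add a b ha hb => rw [map_add, map_add, ha, hb]

end Leavitt

/-! ## The kernel of the connecting homomorphism -/

section Phi

variable (K : Type v) [Field K] [StarRing K] (G : BipartiteSepGraph.{u})

theorem phi_vertex (p : G.Vertex) : G.phi K (Leavitt.vertex K p) = G.phiVertex K p :=
  Leavitt.lift_vertex _ p

theorem phi_edge (e : G.Edge) : G.phi K (Leavitt.edge K e) = G.phiEdge K e :=
  Leavitt.lift_edge _ e

open scoped Classical in
theorem phiEdge_eq (x : G.Edge) : G.phiEdge K x =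
    ∑ y : G.next.Edge with G.prev y = x, star (Leavitt.edge K (G := G.next) y) := rfl

/-- The commutators of the range projections of the edges. -/
def edgeCommutators : Set (Leavitt K G) :=
  {c | ∃ x y : G.Edge, c = ⁅finalProj (Leavitt.edge K x), finalProj (Leavitt.edge K y)⁆}

theorem star_commutator_finalProj {R : Type*} [Ring R] [StarRing R] (a b : R) :
    star ⁅finalProj a, finalProj b⁆ = ⁅finalProj b, finalProj a⁆ := by
  simp [Ring.lie_def, finalProj, mul_assoc]

/-- A two-sided ideal generated by a self-adjoint set is self-adjoint. -/
theorem _root_.TwoSidedIdeal.star_mem_span {R : Type*} [Ring R] [StarRing R] {s : Set R}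
    (hs : ∀ x ∈ s, star x ∈ s) {x : R} (hx : x ∈ TwoSidedIdeal.span s) :
    star x ∈ TwoSidedIdeal.span s := by
  induction hx using TwoSidedIdeal.span_induction with
  | mem x hx => exact TwoSidedIdeal.subset_span (hs x hx)
  | zero => rw [star_zero]; exact TwoSidedIdeal.zero_mem _
  | add x y _ _ hx hy => rw [star_add]; exact TwoSidedIdeal.add_mem _ hx hy
  | neg x _ hx => rw [star_neg]; exact TwoSidedIdeal.neg_mem _ hx
  | left_absorb a x _ hx => rw [star_mul]; exact TwoSidedIdeal.mul_mem_right _ _ _ hx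
  | right_absorb a x _ hx => rw [star_mul]; exact TwoSidedIdeal.mul_mem_left _ _ _ hx

/-- Modulo the commutators the range projections commute, so the quotient carries a family for the
next graph. The induced map from the next Leavitt algebra composes with φ to the quotient map, so
whatever φ kills is zero in the quotient. -/
theorem mem_span_of_phi_eq_zero {a : Leavitt K G} (ha : G.phi K a = 0) :
    a ∈ TwoSidedIdeal.span (G.edgeCommutators K) := by
  classical
  set I := TwoSidedIdeal.span (G.edgeCommutators K) with hI
  have hstar : ∀ x ∈ I, star x ∈ I := fun x => TwoSidedIdeal.star_mem_span (by
    rintro _ ⟨x, y, rfl⟩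
    exact ⟨y, x, star_commutator_finalProj _ _⟩)
  let := I.quotientStarRing hstar
  have : StarModule K I.ringCon.Quotient := ⟨by
    rintro c ⟨x⟩
    exact congrArg I.ringCon.mk' (star_smul c x)⟩
  let π : Leavitt K G →⋆ₐ[K] I.ringCon.Quotient :=
    { I.ringCon.mk' with
      commutes' := fun c => rfl
      map_star' := fun a => rfl }
  have hπ : ∀ a, π a = 0 ↔ a ∈ I := fun a => I.mk'_eq_zero
  have hF : IsFamily (fun p => π (Leavitt.vertex K p)) fun e => π (Leavitt.edge K e) :=
    Leavitt.isFamily.map (π : Leavitt K G →+* I.ringCon.Quotient) fun a => map_star π a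
  obtain ⟨V, hV⟩ := hF.exists_isRefinement fun x y => by
    rw [commute_iff_lie_eq]
    simp only [Ring.lie_def, ← map_star, ← map_mul, ← map_sub]
    exact (hπ _).2 (TwoSidedIdeal.subset_span ⟨x, y, rfl⟩)
  have hN := hV.isFamily_next hF
  have hcomp : (Leavitt.lift hN).comp (G.phi K) = π := by
    refine Leavitt.hom_ext ?_ ?_
    · rintro (w | q)
      · rw [StarAlgHom.comp_apply, phi_vertex, phiVertex, Sum.elim_inl, map_sum]
        simp only [Leavitt.lift_vertex, nextVertex_inr]
        exact hV.sum w
      -- An arrow y over x is sent to x* V, hence y* to V x. Summing over y gives (xx*)x = x.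
      · rw [StarAlgHom.comp_apply, phi_vertex, phiVertex, Sum.elim_inr, Leavitt.lift_vertex]
        rfl
    · intro x
      rw [StarAlgHom.comp_apply, phi_edge, phiEdge_eq, map_sum, ← hF.mul_star_mul_self x,
        ← hV.sum_source hF x, Finset.sum_mul]
      refine Finset.sum_congr rfl fun y hy => ?_
      obtain rfl : G.prev y = x := (Finset.mem_filter.1 hy).2
      rw [map_star, Leavitt.lift_edge, star_mul, star_star, hV.star_eq hF]
  rw [← hπ, ← hcomp, StarAlgHom.comp_apply, ha, map_zero]

end Phi

end BipartiteSepGraph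

end

noncomputable section

namespace BipartiteSepGraph

/-! ## The diagonal subalgebra spanned by the vertices -/

namespace Leavitt

variable (K : Type v) [Field K] [StarRing K] (G : BipartiteSepGraph.{u})

/-- Functions on the vertices as elements of `L(E, C)`. -/
def diagonal : (G.Vertex → K) →ₐ[K] Leavitt K G :=
  AlgHom.ofLinearMap
    { toFun := fun f => ∑ p, f p • vertex K p
      map_add' := fun f g => by simp [add_smul, Finset.sum_add_distrib]
      map_smul' := fun c f => by simp [mul_smul, Finset.smul_sum] }
    (by
      simp only [LinearMap.coe_mk, AddHom.coe_mk, Pi.one_apply, one_smul]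
      exact isFamily.one.symm)
    fun f g => by
      classical
      simp only [LinearMap.coe_mk, AddHom.coe_mk, Finset.sum_mul_sum, smul_mul_smul_comm,
        isFamily.vertex_mul, smul_ite, smul_zero, Finset.sum_ite_eq, Finset.mem_univ, if_true,
        Pi.mul_apply]

variable {K G}

theorem diagonal_apply (f : G.Vertex → K) : diagonal K G f = ∑ p, f p • vertex K p := rfl

theorem vertex_mem_range_diagonal (p : G.Vertex) : vertex K p ∈ (diagonal K G).range := by
  classical
  refine ⟨Pi.single p 1, ?_⟩
  change diagonal K G _ = _
  rw [diagonal_apply, Finset.sum_eq_single p]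
  · simp
  · intro q _ hq
    simp [hq]
  · simp

theorem commute_of_mem_range_diagonal {a b : Leavitt K G} (ha : a ∈ (diagonal K G).range)
    (hb : b ∈ (diagonal K G).range) : Commute a b := by
  obtain ⟨f, rfl⟩ := ha
  obtain ⟨g, rfl⟩ := hb
  exact (Commute.all f g).map (diagonal K G)

theorem edge_mul_vertex_inl (e : G.Edge) (w : G.V0) :
    edge K e * vertex K (Sum.inl w) = 0 := by
  rw [← isFamily.mul_source, mul_assoc, isFamily.vertex_mul, if_neg Sum.inr_ne_inl, mul_zero]

open scoped Classical in
theorem edge_mul_vertex_inr (e : G.Edge) (w : G.V1) :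
    edge K e * vertex K (Sum.inr w) = if G.source e = w then edge K e else 0 := by
  split_ifs with h
  · rw [← h, isFamily.mul_source]
  · rw [← isFamily.mul_source, mul_assoc, isFamily.vertex_mul, if_neg (by simpa using h),
      mul_zero]

theorem star_edge_mul_vertex_inr (e : G.Edge) (w : G.V1) :
    star (edge K e) * vertex K (Sum.inr w) = 0 := by
  rw [← isFamily.star_mul_range, mul_assoc, isFamily.vertex_mul, if_neg Sum.inl_ne_inr, mul_zero]

open scoped Classical in
theorem star_edge_mul_vertex_inl (e : G.Edge) (w : G.V0) :
    star (edge K e) * vertex K (Sum.inl w) = if G.range e = w then star (edge K e) else 0 := by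
  split_ifs with h
  · rw [← h, isFamily.star_mul_range]
  · rw [← isFamily.star_mul_range, mul_assoc, isFamily.vertex_mul, if_neg (by simpa using h),
      mul_zero]

theorem edge_mul_star_eq_zero {e f : G.Edge} (h : G.source e ≠ G.source f) :
    edge K e * star (edge K f) = 0 := by
  rw [← isFamily.mul_source, ← isFamily.source_mul_star f, mul_assoc, ← mul_assoc (vertex K _),
    isFamily.vertex_mul, if_neg (by simpa using h), zero_mul, mul_zero]

theorem star_edge_mul_eq_zero {e f : G.Edge} (h : G.range e ≠ G.range f) :
    star (edge K e) * edge K f = 0 := by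
  rw [← isFamily.star_mul_range, ← isFamily.range_mul f, mul_assoc, ← mul_assoc (vertex K _),
    isFamily.vertex_mul, if_neg (by simpa using h), zero_mul, mul_zero]

end Leavitt

/-! ## The image of the connecting homomorphism -/

section PhiRange

variable (K : Type v) [Field K] [StarRing K] (G : BipartiteSepGraph.{u})

-- The arrows coming from x form one block of the next graph, so in the double sum of terms y* z
-- only the diagonal ones y* y = s(y) survive.
open scoped Classical in
theorem phi_finalProj_edge (x : G.Edge) : G.phi K (finalProj (Leavitt.edge K x)) =
    ∑ a : G.next.Edge with G.prev a = x,
      Leavitt.vertex K (G := G.next) (Sum.inr (G.next.source a)) := by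
  rw [finalProj, map_mul, map_star, phi_edge, phiEdge_eq, star_sum, Finset.sum_mul_sum]
  refine Finset.sum_congr rfl fun a ha => ?_
  rw [Finset.sum_eq_single_of_mem a ha]
  · rw [star_star, Leavitt.isFamily.sck1 a a rfl, if_pos rfl]
  · intro b hb hba
    have hab : G.next.block a = G.next.block b :=
      ((Finset.mem_filter.1 ha).2.trans (Finset.mem_filter.1 hb).2.symm : G.prev a = G.prev b)
    rw [star_star, Leavitt.isFamily.sck1 a b hab, if_neg hba.symm]

theorem phi_diagonal_mem {a : Leavitt K G} (ha : a ∈ (Leavitt.diagonal K G).range) :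
    G.phi K a ∈ (Leavitt.diagonal K G.next).range := by
  classical
  obtain ⟨f, rfl⟩ := ha
  change G.phi K (Leavitt.diagonal K G f) ∈ _
  rw [Leavitt.diagonal_apply, map_sum]
  refine Subalgebra.sum_mem _ fun p _ => ?_
  rw [map_smul]
  refine Subalgebra.smul_mem _ ?_ _
  rw [phi_vertex]
  rcases p with u | w
  · exact Subalgebra.sum_mem _ fun q _ => Leavitt.vertex_mem_range_diagonal _
  · exact Leavitt.vertex_mem_range_diagonal _

theorem phi_finalProj_edge_mem (x : G.Edge) :
    G.phi K (finalProj (Leavitt.edge K x)) ∈ (Leavitt.diagonal K G.next).range := by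
  classical
  rw [phi_finalProj_edge]
  exact Subalgebra.sum_mem _ fun a _ => Leavitt.vertex_mem_range_diagonal _

/-- A new vertex is a product of images of range projections of edges. -/
theorem vertex_mem_adjoin_phi (q : G.next.V1) :
    Leavitt.vertex K (G := G.next) (Sum.inr q) ∈
      Algebra.adjoin K (Set.range fun x : G.Edge => G.phi K (finalProj (Leavitt.edge K x))) := by
  classical
  set B := Algebra.adjoin K
    (Set.range fun x : G.Edge => G.phi K (finalProj (Leavitt.edge K x))) with hB
  -- χ x is the indicator of the new vertices whose family contains x, and corresponds to φ(xx*).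
  -- The product of χ x over the family of q is the indicator of q alone, because a new vertex with
  -- a different family misses some member of this one.
  let χ : G.Edge → G.next.Vertex → K := fun x =>
    Sum.elim 0 fun q' => if ∃ a, G.next.source a = q' ∧ G.prev a = x then 1 else 0
  have hχ : ∀ x, Leavitt.diagonal K G.next (χ x) = G.phi K (finalProj (Leavitt.edge K x)) := by
    intro x
    rw [phi_finalProj_edge, Leavitt.diagonal_apply, Fintype.sum_sum_type]
    simp only [χ, Sum.elim_inl, Pi.zero_apply, zero_smul, Finset.sum_const_zero, zero_add,
      Sum.elim_inr, ite_smul, one_smul]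
    rw [← Finset.sum_filter]
    symm
    refine Finset.sum_bij (fun a _ => G.next.source a) ?_ ?_ ?_ fun _ _ => rfl
    · intro a ha
      exact Finset.mem_filter.2 ⟨Finset.mem_univ _, a, rfl, (Finset.mem_filter.1 ha).2⟩
    · intro a ha b hb hab
      exact G.eq_of_source_eq hab
        (by rw [(Finset.mem_filter.1 ha).2, (Finset.mem_filter.1 hb).2])
    · intro q' hq'
      obtain ⟨a, ha, hax⟩ := (Finset.mem_filter.1 hq').2
      exact ⟨a, Finset.mem_filter.2 ⟨Finset.mem_univ _, hax⟩, ha⟩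
  have hmem : ∀ x, χ x ∈ B.comap (Leavitt.diagonal K G.next) := fun x => by
    rw [Subalgebra.mem_comap, hχ]
    exact Algebra.subset_adjoin ⟨x, rfl⟩
  have hprod := Subalgebra.prod_mem (B.comap (Leavitt.diagonal K G.next))
    (t := Finset.univ.filter fun x => ∃ a, G.next.source a = q ∧ G.prev a = x)
    (f := χ) fun x _ => hmem x
  have e : (∏ x ∈ Finset.univ.filter fun x => ∃ a, G.next.source a = q ∧ G.prev a = x, χ x) =
      Pi.single (Sum.inr q) 1 := by
    funext p
    rw [Finset.prod_apply]
    rcases p with w | q'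
    · rw [Pi.single_eq_of_ne Sum.inl_ne_inr]
      obtain ⟨a, ha⟩ := G.next.source_surjective q
      exact Finset.prod_eq_zero (i := G.prev a)
        (Finset.mem_filter.2 ⟨Finset.mem_univ _, a, ha, rfl⟩) rfl
    · by_cases hq : q = q'
      · subst hq
        rw [Pi.single_eq_same]
        refine Finset.prod_eq_one fun x hx => ?_
        exact if_pos (Finset.mem_filter.1 hx).2
      · rw [Pi.single_eq_of_ne fun h => hq (Sum.inr_injective h).symm]
        obtain ⟨a, ha, ha'⟩ := IsRefinement.exists_of_ne hq
        refine Finset.prod_eq_zero (i := G.prev a)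
          (Finset.mem_filter.2 ⟨Finset.mem_univ _, a, ha, rfl⟩) ?_
        refine if_neg ?_
        rintro ⟨a', h1, h2⟩
        exact ha' a' h1 h2
  rw [e, Subalgebra.mem_comap, Leavitt.diagonal_apply, Finset.sum_eq_single (Sum.inr q)] at hprod
  · simpa using hprod
  · intro p _ hp
    simp [hp]
  · simp

/-- φ(x)* is the sum of the arrows coming from x, whose sources are distinct; multiplying by one
source vertex selects one arrow. -/
theorem edge_eq_star_phi_mul (a : G.next.Edge) : Leavitt.edge K (G := G.next) a =
    star (G.phi K (Leavitt.edge K (G.prev a))) *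
      Leavitt.vertex K (G := G.next) (Sum.inr (G.next.source a)) := by
  classical
  rw [phi_edge, phiEdge_eq, star_sum, Finset.sum_mul, Finset.sum_eq_single a]
  · rw [star_star, Leavitt.isFamily.mul_source]
  · intro b hb hba
    rw [star_star, Leavitt.edge_mul_vertex_inr, if_neg]
    intro hs
    exact hba (G.eq_of_source_eq hs (by rw [(Finset.mem_filter.1 hb).2]))
  · intro ha
    simp at ha

/-- The old vertices w, the new vertices (products of images of range projections) and the arrows
(images of x* times new vertices) are all in the image. -/
theorem phi_surjective : Function.Surjective (G.phi K) := by
  have hadj : ∀ q : G.next.V1, ∃ b, G.phi K b = Leavitt.vertex K (G := G.next) (Sum.inr q) := by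
    intro q
    have h := G.vertex_mem_adjoin_phi K q
    have hle : Algebra.adjoin K
        (Set.range fun x : G.Edge => G.phi K (finalProj (Leavitt.edge K x))) ≤
        (G.phi K : Leavitt K G →ₐ[K] Leavitt K G.next).range := by
      rw [Algebra.adjoin_le_iff]
      rintro _ ⟨x, rfl⟩
      exact ⟨_, rfl⟩
    exact hle h
  intro a
  induction a using Leavitt.induction with
  | alg r => exact ⟨algebraMap K _ r, AlgHomClass.commutes _ r⟩
  | vertex p =>
    rcases p with w | q
    · exact ⟨Leavitt.vertex K (Sum.inr (show G.V1 from w)), G.phi_vertex K _⟩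
    · exact hadj q
  | edge a =>
    obtain ⟨b, hb⟩ := hadj (G.next.source a)
    refine ⟨star (Leavitt.edge K (G.prev a)) * b, ?_⟩
    rw [map_mul, map_star, hb, ← edge_eq_star_phi_mul]
  | star a ha =>
    obtain ⟨b, rfl⟩ := ha
    exact ⟨star b, map_star _ b⟩
  | mul a b ha hb =>
    obtain ⟨a, rfl⟩ := ha
    obtain ⟨b, rfl⟩ := hb
    exact ⟨a * b, map_mul _ _ _⟩
  | add a b ha hb =>
    obtain ⟨a, rfl⟩ := ha
    obtain ⟨b, rfl⟩ := hb
    exact ⟨a + b, map_add _ _ _⟩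

theorem Phi_surjective (n : ℕ) : Function.Surjective (G.Phi K n) := by
  induction n with
  | zero => exact Function.surjective_id
  | succ n ih => exact ((G.canonical n).phi_surjective K).comp ih

theorem Phi_succ_apply (n : ℕ) (a : Leavitt K G) :
    G.Phi K (n + 1) a = (G.canonical n).phi K (G.Phi K n a) := rfl

end PhiRange

/-! ## Images of edges along the canonical sequence -/

/-- A set of edges with distinct sources in which edges with the same range lie in the same
block. -/
structure IsSpread (G : BipartiteSepGraph.{u}) (D : Finset G.Edge) : Prop where
  eq_of_source_eq : ∀ a ∈ D, ∀ b ∈ D, G.source a = G.source b → a = b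
  block_eq : ∀ a ∈ D, ∀ b ∈ D, G.range a = G.range b → G.block a = G.block b

section Spread

variable {K : Type v} [Field K] [StarRing K] {G : BipartiteSepGraph.{u}} {D : Finset G.Edge}

-- The two conditions exchange roles. Arrows with equal source have parents with equal range, hence
-- in one block, which forces the arrows to be equal. Arrows with equal range have parents with
-- equal source, hence equal parents, and so lie in one block.
open scoped Classical in
theorem IsSpread.next (hD : IsSpread G D) :
    IsSpread G.next (Finset.univ.filter fun a => G.prev a ∈ D) where
  eq_of_source_eq a ha b hb hab := by
    refine G.eq_of_source_eq hab
      (hD.block_eq _ (Finset.mem_filter.1 ha).2 _ (Finset.mem_filter.1 hb).2 ?_)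
    rw [← root_source_eq, ← root_source_eq, hab]
  block_eq a ha b hb hab :=
    hD.eq_of_source_eq _ (Finset.mem_filter.1 ha).2 _ (Finset.mem_filter.1 hb).2 hab

open scoped Classical in
theorem sum_phiEdge (D : Finset G.Edge) : ∑ x ∈ D, G.phiEdge K x =
    ∑ a : G.next.Edge with G.prev a ∈ D, star (Leavitt.edge K (G := G.next) a) := by
  simp only [phiEdge_eq]
  rw [← Finset.sum_fiberwise_of_maps_to (s := Finset.univ.filter fun a => G.prev a ∈ D) (t := D)
    (g := G.prev) (fun a ha => (Finset.mem_filter.1 ha).2)]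
  refine Finset.sum_congr rfl fun x hx => ?_
  rw [Finset.filter_filter]
  refine Finset.sum_congr (Finset.filter_congr fun a _ => ?_) fun _ _ => rfl
  constructor
  · rintro rfl
    exact ⟨hx, rfl⟩
  · exact fun h => h.2

theorem IsSpread.sum_edge_mul_vertex (hD : IsSpread G D) {a : G.Edge} (ha : a ∈ D) :
    (∑ b ∈ D, Leavitt.edge K b) * Leavitt.vertex K (Sum.inr (G.source a)) = Leavitt.edge K a := by
  classical
  rw [Finset.sum_mul, Finset.sum_eq_single_of_mem a ha]
  · rw [Leavitt.isFamily.mul_source]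
  · intro b hb hba
    rw [Leavitt.edge_mul_vertex_inr, if_neg fun h => hba (hD.eq_of_source_eq b hb a ha h)]

/-- A term a p b* vanishes unless a and b share the source p, and then a = b. The surviving aa* need
not be diagonal, but φ sends it to a sum of vertices; this is where a step of the sequence is spent.
-/
theorem IsSpread.phi_sum_edge_conj_mem (hD : IsSpread G D) {d : Leavitt K G}
    (hd : d ∈ (Leavitt.diagonal K G).range) :
    G.phi K ((∑ b ∈ D, Leavitt.edge K b) * d * star (∑ b ∈ D, Leavitt.edge K b)) ∈
      (Leavitt.diagonal K G.next).range := by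
  classical
  obtain ⟨f, rfl⟩ := hd
  change G.phi K (_ * Leavitt.diagonal K G f * _) ∈ _
  rw [Leavitt.diagonal_apply, Finset.mul_sum, Finset.sum_mul, map_sum]
  refine Subalgebra.sum_mem _ fun p _ => ?_
  rw [mul_smul_comm, smul_mul_assoc, map_smul]
  refine Subalgebra.smul_mem _ ?_ _
  rw [star_sum, Finset.sum_mul, Finset.sum_mul_sum, map_sum]
  refine Subalgebra.sum_mem _ fun a ha => ?_
  rw [map_sum]
  refine Subalgebra.sum_mem _ fun b hb => ?_
  rcases p with w | w
  · rw [Leavitt.edge_mul_vertex_inl, zero_mul, map_zero]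
    exact Subalgebra.zero_mem _
  · rw [Leavitt.edge_mul_vertex_inr]
    split_ifs with h
    · by_cases hab : G.source a = G.source b
      · obtain rfl := hD.eq_of_source_eq a ha b hb hab
        exact G.phi_finalProj_edge_mem K a
      · rw [Leavitt.edge_mul_star_eq_zero hab, map_zero]
        exact Subalgebra.zero_mem _
    · rw [zero_mul, map_zero]
      exact Subalgebra.zero_mem _

/-- A term a* p b vanishes unless a and b share the range p. They then lie in the same block, and
(SCK1) makes a* b a vertex or zero, without applying φ. -/
theorem IsSpread.sum_star_edge_conj_mem (hD : IsSpread G D) {d : Leavitt K G}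
    (hd : d ∈ (Leavitt.diagonal K G).range) :
    (∑ b ∈ D, star (Leavitt.edge K b)) * d * star (∑ b ∈ D, star (Leavitt.edge K b)) ∈
      (Leavitt.diagonal K G).range := by
  classical
  obtain ⟨f, rfl⟩ := hd
  change _ * Leavitt.diagonal K G f * _ ∈ _
  rw [Leavitt.diagonal_apply, Finset.mul_sum, Finset.sum_mul]
  refine Subalgebra.sum_mem _ fun p _ => ?_
  rw [mul_smul_comm, smul_mul_assoc]
  refine Subalgebra.smul_mem _ ?_ _
  rw [star_sum, Finset.sum_mul, Finset.sum_mul_sum]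
  refine Subalgebra.sum_mem _ fun a ha => Subalgebra.sum_mem _ fun b hb => ?_
  rw [star_star]
  rcases p with w | w
  · rw [Leavitt.star_edge_mul_vertex_inl]
    split_ifs with h
    · by_cases hab : G.range a = G.range b
      · rw [Leavitt.isFamily.sck1 a b (hD.block_eq a ha b hb hab)]
        split_ifs
        · exact Leavitt.vertex_mem_range_diagonal _
        · exact Subalgebra.zero_mem _
      · rw [Leavitt.star_edge_mul_eq_zero hab]
        exact Subalgebra.zero_mem _
    · rw [zero_mul]
      exact Subalgebra.zero_mem _
  · rw [Leavitt.star_edge_mul_vertex_inr, zero_mul]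
    exact Subalgebra.zero_mem _

/-- Each edge is sent to the sum of the edges in a spread set, or of their adjoints, and each edge
of the target occurs in one of these sets. -/
def IsSpreadHom {H : BipartiteSepGraph.{u}} (F : Leavitt K G →⋆ₐ[K] Leavitt K H) : Prop :=
  ∃ D : G.Edge → Finset H.Edge, (∀ x, IsSpread H (D x)) ∧ (∀ a, ∃ x, a ∈ D x) ∧
    ∀ x, F (Leavitt.edge K x) = ∑ a ∈ D x, Leavitt.edge K a ∨
      F (Leavitt.edge K x) = ∑ a ∈ D x, star (Leavitt.edge K a)

/-- φ sends an edge to the adjoints of the arrows over it, so the alternatives "edges" and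
"adjoints" are interchanged while spreadness is inherited. -/
theorem IsSpreadHom.phi_comp {H : BipartiteSepGraph.{u}} {F : Leavitt K G →⋆ₐ[K] Leavitt K H}
    (hF : IsSpreadHom F) : IsSpreadHom ((H.phi K).comp F) := by
  classical
  obtain ⟨D, hD, hmem, hF⟩ := hF
  refine ⟨fun x => Finset.univ.filter fun a => H.prev a ∈ D x, fun x => (hD x).next,
    fun a => ?_, fun x => ?_⟩
  · obtain ⟨x, hx⟩ := hmem (H.prev a)
    exact ⟨x, Finset.mem_filter.2 ⟨Finset.mem_univ _, hx⟩⟩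
  · have h := sum_phiEdge (K := K) (D x)
    rw [StarAlgHom.comp_apply]
    rcases hF x with hx | hx
    · right
      rw [hx, map_sum]
      simp only [phi_edge]
      exact h
    · left
      rw [hx, map_sum]
      simp only [map_star, phi_edge]
      rw [← star_sum, h, star_sum]
      exact Finset.sum_congr rfl fun a _ => star_star _

variable (K G) in
theorem isSpreadHom_Phi (n : ℕ) : IsSpreadHom (G.Phi K n) := by
  classical
  induction n with
  | zero =>
    refine ⟨fun x => ({x} : Finset G.Edge), fun x => ⟨?_, ?_⟩,
      fun a => ⟨a, Finset.mem_singleton_self _⟩, fun x => Or.inl ?_⟩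
    · intro a ha b hb _
      exact (Finset.mem_singleton.1 ha).trans (Finset.mem_singleton.1 hb).symm
    · intro a ha b hb _
      exact congrArg _ ((Finset.mem_singleton.1 ha).trans (Finset.mem_singleton.1 hb).symm)
    · exact (Finset.sum_singleton (fun a : G.Edge => Leavitt.edge K a) x).symm
  | succ n ih => exact ih.phi_comp

end Spread

/-! ## Range projections of words -/

section Words

variable (K : Type v) [Field K] [StarRing K] (G : BipartiteSepGraph.{u})

theorem finalProj_mul {R : Type*} [Ring R] [StarRing R] (a b : R) :
    finalProj (a * b) = a * finalProj b * star a := by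
  simp only [finalProj, star_mul, mul_assoc]

theorem exists_spread_Phi_of_letter (n : ℕ) {t : Leavitt K G}
    (ht : ∃ x, t = Leavitt.edge K x ∨ t = star (Leavitt.edge K x)) :
    ∃ D, IsSpread (G.canonical n) D ∧ (G.Phi K n t = ∑ a ∈ D, Leavitt.edge K a ∨
      G.Phi K n t = ∑ a ∈ D, star (Leavitt.edge K a)) := by
  obtain ⟨D, hD, -, h⟩ := isSpreadHom_Phi K G n
  obtain ⟨x, rfl | rfl⟩ := ht
  · exact ⟨D x, hD x, h x⟩
  · refine ⟨D x, hD x, ?_⟩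
    rw [map_star]
    rcases h x with h | h
    · right
      rw [h, star_sum]
    · left
      rw [h, star_sum]
      exact Finset.sum_congr rfl fun a _ => star_star _

/-- Lengthening a word by one letter costs one step of the sequence: the image of a letter is a sum
over a spread set, and conjugating by it keeps the diagonal after one further φ. -/
theorem Phi_succ_conj_mem (n : ℕ) {t a : Leavitt K G}
    (ht : ∃ x, t = Leavitt.edge K x ∨ t = star (Leavitt.edge K x))
    (ha : G.Phi K n a ∈ (Leavitt.diagonal K (G.canonical n)).range) :
    G.Phi K (n + 1) (t * a * star t) ∈ (Leavitt.diagonal K (G.canonical (n + 1))).range := by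
  obtain ⟨D, hD, h⟩ := G.exists_spread_Phi_of_letter K n ht
  rw [Phi_succ_apply, map_mul (G.Phi K n), map_mul (G.Phi K n), map_star (G.Phi K n)]
  rcases h with h | h
  · rw [h]
    exact hD.phi_sum_edge_conj_mem ha
  · rw [h]
    exact phi_diagonal_mem K _ (hD.sum_star_edge_conj_mem ha)

theorem Phi_finalProj_list_prod_mem (n : ℕ) (l : List (Leavitt K G)) (hl : l.length ≤ n)
    (h : ∀ a ∈ l, ∃ x, a = Leavitt.edge K x ∨ a = star (Leavitt.edge K x)) :
    G.Phi K n (finalProj l.prod) ∈ (Leavitt.diagonal K (G.canonical n)).range := by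
  -- Unlike in `words`, the empty list is allowed here, so the induction can start from e(1) = 1.
  induction n generalizing l with
  | zero =>
    obtain rfl := List.length_eq_zero_iff.1 (Nat.le_zero.1 hl)
    simp [finalProj]
  | succ n ih =>
    cases l with
    | nil => simp [finalProj]
    | cons t l =>
      rw [List.prod_cons, finalProj_mul]
      exact G.Phi_succ_conj_mem K n (h t (by simp))
        (ih l (by simpa using hl) fun a ha => h a (by simp [ha]))

theorem Phi_finalProj_mem {n : ℕ} {w : Leavitt K G}
    (hw : w ∈ words (Leavitt.edge K (G := G)) n) :
    G.Phi K n (finalProj w) ∈ (Leavitt.diagonal K (G.canonical n)).range := by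
  obtain ⟨l, -, hl, h, rfl⟩ := hw
  exact G.Phi_finalProj_list_prod_mem K n l hl h

theorem J_le_ker_Phi (n : ℕ) : G.J K n ≤ TwoSidedIdeal.ker (G.Phi K n) := by
  rw [J, TwoSidedIdeal.span_le]
  rintro _ ⟨w, hw, w', hw', rfl⟩
  rw [SetLike.mem_coe, TwoSidedIdeal.mem_ker, Ring.lie_def, map_sub, map_mul, map_mul,
    (Leavitt.commute_of_mem_range_diagonal (G.Phi_finalProj_mem K hw)
      (G.Phi_finalProj_mem K hw')).eq, sub_self]

/-- The subalgebra of `L(E_n, C^n)` generated by the images of the projections `e(w)`, for words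
`w` of length at most `m`. -/
def wordAlgebra (n m : ℕ) : Subalgebra K (Leavitt K (G.canonical n)) :=
  Algebra.adjoin K ((fun w => G.Phi K n (finalProj w)) '' words (Leavitt.edge K (G := G)) m)

theorem letter_mem_words {R ι : Type*} [Ring R] [StarRing R] (t : ι → R) {n : ℕ} (hn : 1 ≤ n)
    {a : R} (ha : ∃ x, a = t x ∨ a = star (t x)) : a ∈ words t n :=
  ⟨[a], by simp, by simpa using hn, by simpa using ha, by simp⟩

theorem mul_mem_words {R ι : Type*} [Ring R] [StarRing R] (t : ι → R) {n : ℕ}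
    {a w : R} (ha : ∃ x, a = t x ∨ a = star (t x)) (hw : w ∈ words t n) :
    a * w ∈ words t (n + 1) := by
  obtain ⟨l, -, hl, h, rfl⟩ := hw
  exact ⟨a :: l, by simp, by simpa using hl, by
    rintro b (_ | ⟨_, hb⟩)
    exacts [ha, h b hb], by simp⟩

theorem wordAlgebra_le_diagonal (n : ℕ) :
    G.wordAlgebra K n n ≤ (Leavitt.diagonal K (G.canonical n)).range := by
  rw [wordAlgebra, Algebra.adjoin_le_iff]
  rintro _ ⟨w, hw, rfl⟩
  exact G.Phi_finalProj_mem K hw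

theorem phi_mem_wordAlgebra {n m : ℕ} {b : Leavitt K (G.canonical n)}
    (hb : b ∈ G.wordAlgebra K n m) : (G.canonical n).phi K b ∈ G.wordAlgebra K (n + 1) m := by
  have hle : G.wordAlgebra K n m ≤ (G.wordAlgebra K (n + 1) m).comap
      ((G.canonical n).phi K : Leavitt K (G.canonical n) →ₐ[K] Leavitt K (G.canonical n).next) := by
    rw [wordAlgebra, Algebra.adjoin_le_iff]
    rintro _ ⟨w, hw, rfl⟩
    exact Algebra.subset_adjoin ⟨w, hw, rfl⟩
  exact hle hb

theorem letter_mul_star_mul_self {t : Leavitt K G}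
    (ht : ∃ x, t = Leavitt.edge K x ∨ t = star (Leavitt.edge K x)) : t * star t * t = t := by
  obtain ⟨x, rfl | rfl⟩ := ht
  · exact Leavitt.isFamily.mul_star_mul_self x
  · have h := congrArg star ((Leavitt.isFamily (K := K)).mul_star_mul_self x)
    rw [star_star]
    rwa [star_mul, star_mul, star_star, ← mul_assoc] at h

/-- Conjugation by s = Φ_n(t) turns Φ_n(e(w)) into Φ_n(e(tw)). It is multiplicative on the algebra
of words of length at most n, because s*s commutes with that algebra and ss*s = s; so it is enough
to treat generators. -/
theorem conj_mem_wordAlgebra {n : ℕ} (hn : 1 ≤ n) {t : Leavitt K G}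
    (ht : ∃ x, t = Leavitt.edge K x ∨ t = star (Leavitt.edge K x))
    {b : Leavitt K (G.canonical n)} (hb : b ∈ G.wordAlgebra K n n) :
    G.Phi K n t * b * star (G.Phi K n t) ∈ G.wordAlgebra K n (n + 1) := by
  have ht' : ∃ x, star t = Leavitt.edge K x ∨ star t = star (Leavitt.edge K x) := by
    obtain ⟨x, rfl | rfl⟩ := ht
    · exact ⟨x, Or.inr rfl⟩
    · exact ⟨x, Or.inl (star_star _)⟩
  rw [wordAlgebra] at hb
  induction hb using Algebra.adjoin_induction with
  | mem b hb =>
    obtain ⟨w, hw, rfl⟩ := hb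
    refine Algebra.subset_adjoin (Set.mem_image _ _ _ |>.2 ⟨t * w, mul_mem_words _ ht hw, ?_⟩)
    simp only [finalProj_mul, map_mul, map_star]
  | algebraMap r =>
    have hmem : G.Phi K n (finalProj t) ∈ G.wordAlgebra K n (n + 1) :=
      Algebra.subset_adjoin ⟨t, letter_mem_words _ (Nat.le_add_left 1 n) ht, rfl⟩
    rw [← Algebra.commutes, mul_assoc, ← Algebra.smul_def, ← map_star, ← map_mul]
    exact Subalgebra.smul_mem _ hmem r
  | add b c _ _ hb hc =>
    rw [mul_add, add_mul]
    exact Subalgebra.add_mem _ hb hc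
  | mul b c hb hc hb' hc' =>
    -- Here s*s = Φ_n(e(t*)), and t* is a word of length 1 ≤ n, so both factors lie in the diagonal.
    have hcomm : Commute (star (G.Phi K n t) * G.Phi K n t) b := by
      refine Leavitt.commute_of_mem_range_diagonal ?_ (G.wordAlgebra_le_diagonal K n hb)
      have h := G.Phi_finalProj_mem K (letter_mem_words _ hn ht')
      rwa [finalProj, star_star, map_mul, map_star] at h
    have hself : G.Phi K n t * star (G.Phi K n t) * G.Phi K n t = G.Phi K n t := by
      rw [← map_star, ← map_mul, ← map_mul, G.letter_mul_star_mul_self K ht]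
    have e : G.Phi K n t * (b * c) * star (G.Phi K n t) =
        (G.Phi K n t * b * star (G.Phi K n t)) * (G.Phi K n t * c * star (G.Phi K n t)) := by
      generalize G.Phi K n t = s at *
      calc s * (b * c) * star s = s * (star s * s * b) * c * star s := by
            rw [← mul_assoc s (star s * s) b, ← mul_assoc s (star s), hself, mul_assoc s b c]
        _ = _ := by
            rw [hcomm.eq]
            simp only [mul_assoc]
    rw [e]
    exact Subalgebra.mul_mem _ hb' hc'

/-- By induction, the new vertices of E_{n+1}, being products of the φ(bb*) with b an edge of E_n,
come from words of length at most n + 1. An edge a of E_{n+1} occurs in the image of some letter t,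
and aa* = Φ(t) s(a) Φ(t)*, which adds one letter: hence the length n + 2 at level n + 1. -/
theorem finalProj_edge_mem_wordAlgebra (n : ℕ) (a : (G.canonical n).Edge) :
    finalProj (Leavitt.edge K a) ∈ G.wordAlgebra K n (n + 1) := by
  induction n with
  | zero =>
    exact Algebra.subset_adjoin
      ⟨Leavitt.edge K (show G.Edge from a), letter_mem_words _ le_rfl ⟨_, Or.inl rfl⟩, rfl⟩
  | succ n ih =>
    have hv : Leavitt.vertex K (G := G.canonical (n + 1))
        (Sum.inr ((G.canonical (n + 1)).source a)) ∈ G.wordAlgebra K (n + 1) (n + 1) := by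
      let B : Subalgebra K (Leavitt K (G.canonical n).next) := G.wordAlgebra K (n + 1) (n + 1)
      have hle : Algebra.adjoin K (Set.range fun x : (G.canonical n).Edge =>
          (G.canonical n).phi K (finalProj (Leavitt.edge K x))) ≤ B := by
        rw [Algebra.adjoin_le_iff]
        rintro _ ⟨x, rfl⟩
        exact G.phi_mem_wordAlgebra K (ih x)
      exact hle ((G.canonical n).vertex_mem_adjoin_phi K _)
    obtain ⟨D, hD, hmem, h⟩ := isSpreadHom_Phi K G (n + 1)
    obtain ⟨x, hx⟩ := hmem a
    -- Choose x or x* so that the image is a sum of edges rather than of adjoints; distinct sources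
    -- then let s(a) cut out a.
    obtain ⟨t, ht, hPhi⟩ : ∃ t, (∃ x, t = Leavitt.edge K x ∨ t = star (Leavitt.edge K x)) ∧
        G.Phi K (n + 1) t = ∑ b ∈ D x, Leavitt.edge K b := by
      rcases h x with h | h
      · exact ⟨_, ⟨x, Or.inl rfl⟩, h⟩
      · refine ⟨_, ⟨x, Or.inr rfl⟩, ?_⟩
        rw [map_star, h, star_sum]
        exact Finset.sum_congr rfl fun a _ => star_star _
    have key := G.conj_mem_wordAlgebra K (Nat.le_add_left 1 n) ht hv
    have e := (hD x).sum_edge_mul_vertex (K := K) hx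
    rw [← hPhi] at e
    have e' : finalProj (Leavitt.edge K a) = G.Phi K (n + 1) t *
        Leavitt.vertex K (G := G.canonical (n + 1)) (Sum.inr ((G.canonical (n + 1)).source a)) *
          star (G.Phi K (n + 1) t) := by
      rw [finalProj, ← e, star_mul, ← Leavitt.isFamily.vertex_star, mul_assoc, mul_assoc,
        ← mul_assoc (Leavitt.vertex K _), Leavitt.isFamily.vertex_mul, if_pos rfl]
    rw [e']
    exact key

/-- The elements of two subalgebras commute modulo a two-sided ideal if their generators do. -/
theorem lie_mem_of_mem_adjoin {F A : Type*} [Field F] [Ring A] [Algebra F A] (I : TwoSidedIdeal A) {s : Set A}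
    (hs : ∀ a ∈ s, ∀ b ∈ s, ⁅a, b⁆ ∈ I) {a b : A} (ha : a ∈ Algebra.adjoin F s)
    (hb : b ∈ Algebra.adjoin F s) : ⁅a, b⁆ ∈ I := by
  let π : A →ₐ[F] I.ringCon.Quotient := { I.ringCon.mk' with commutes' := fun _ => rfl }
  have hπ : ∀ a b, ⁅a, b⁆ ∈ I ↔ π a * π b = π b * π a := fun a b => by
    rw [← I.mk'_eq_zero, Ring.lie_def, map_sub, map_mul, map_mul, sub_eq_zero]
    rfl
  rw [hπ]
  have := Algebra.isMulCommutative_adjoin F (s := π '' s) (by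
    rintro _ ⟨a, ha, rfl⟩ _ ⟨b, hb, rfl⟩
    exact (hπ a b).1 (hs a ha b hb))
  have hmem : ∀ {c}, c ∈ Algebra.adjoin F s → π c ∈ Algebra.adjoin F (π '' s) := fun {c} hc => by
    rw [← AlgHom.map_adjoin]
    exact ⟨c, hc, rfl⟩
  exact setLike_mul_comm (hmem ha) (hmem hb)

/-- Surjectivity of f is what lifts the left and right multipliers. -/
theorem exists_mem_span_of_mem_span_image {A B : Type*} [Ring A] [Ring B] (f : A →+* B)
    (hf : Function.Surjective f) (s : Set A) {b : B} (hb : b ∈ TwoSidedIdeal.span (f '' s)) :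
    ∃ a ∈ TwoSidedIdeal.span s, f a = b := by
  induction hb using TwoSidedIdeal.span_induction with
  | mem b hb =>
    obtain ⟨a, ha, rfl⟩ := hb
    exact ⟨a, TwoSidedIdeal.subset_span ha, rfl⟩
  | zero => exact ⟨0, TwoSidedIdeal.zero_mem _, map_zero f⟩
  | add x y _ _ hx hy =>
    obtain ⟨x, hx, rfl⟩ := hx
    obtain ⟨y, hy, rfl⟩ := hy
    exact ⟨x + y, TwoSidedIdeal.add_mem _ hx hy, map_add f x y⟩
  | neg x _ hx =>
    obtain ⟨x, hx, rfl⟩ := hx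
    exact ⟨-x, TwoSidedIdeal.neg_mem _ hx, map_neg f x⟩
  | left_absorb c x _ hx =>
    obtain ⟨x, hx, rfl⟩ := hx
    obtain ⟨c, rfl⟩ := hf c
    exact ⟨c * x, TwoSidedIdeal.mul_mem_left _ _ _ hx, map_mul f c x⟩
  | right_absorb c x _ hx =>
    obtain ⟨x, hx, rfl⟩ := hx
    obtain ⟨c, rfl⟩ := hf c
    exact ⟨x * c, TwoSidedIdeal.mul_mem_right _ _ _ hx, map_mul f x c⟩

theorem words_mono {R ι : Type*} [Ring R] [StarRing R] (t : ι → R) {m n : ℕ} (h : m ≤ n) :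
    words t m ⊆ words t n := by
  rintro w ⟨l, h0, hl, h1, h2⟩
  exact ⟨l, h0, hl.trans h, h1, h2⟩

theorem J_mono {m n : ℕ} (h : m ≤ n) : G.J K m ≤ G.J K n := by
  refine TwoSidedIdeal.span_mono ?_
  rintro _ ⟨w, hw, w', hw', rfl⟩
  exact ⟨w, words_mono _ h hw, w', words_mono _ h hw', rfl⟩

/-- Φ_n(a) lies in the ideal generated by the commutators of the range projections at level n. These
already lie in the ideal generated by the images of the generators of J_{n+1}, so a agrees modulo
ker Φ_n with an element b of J_{n+1}. -/
theorem mem_J_of_Phi_eq_zero (n : ℕ) {a : Leavitt K G} (ha : G.Phi K n a = 0) : a ∈ G.J K n := by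
  induction n generalizing a with
  | zero =>
    obtain rfl : a = 0 := ha
    exact TwoSidedIdeal.zero_mem _
  | succ n ih =>
    have h1 := (G.canonical n).mem_span_of_phi_eq_zero K ha
    have h2 : TwoSidedIdeal.span ((G.canonical n).edgeCommutators K) ≤ TwoSidedIdeal.span
        ((G.Phi K n : Leavitt K G →+* Leavitt K (G.canonical n)) ''
          finalProjCommutators (Leavitt.edge K (G := G)) (n + 1)) := by
      rw [TwoSidedIdeal.span_le]
      rintro _ ⟨x, y, rfl⟩
      refine lie_mem_of_mem_adjoin _ ?_ (G.finalProj_edge_mem_wordAlgebra K n x)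
        (G.finalProj_edge_mem_wordAlgebra K n y)
      rintro _ ⟨w, hw, rfl⟩ _ ⟨w', hw', rfl⟩
      refine TwoSidedIdeal.subset_span ⟨_, ⟨w, hw, w', hw', rfl⟩, ?_⟩
      simp [Ring.lie_def]
    obtain ⟨b, hb, hab⟩ := exists_mem_span_of_mem_span_image _ (G.Phi_surjective K n) _ (h2 h1)
    have h3 : a - b ∈ G.J K n := ih (by
      rw [map_sub, sub_eq_zero]
      exact hab.symm)
    have h4 := TwoSidedIdeal.add_mem _ (G.J_mono K n.le_succ h3) hb
    rwa [sub_add_cancel] at h4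

theorem ker_Phi (n : ℕ) : TwoSidedIdeal.ker (G.Phi K n) = G.J K n :=
  le_antisymm (fun _ ha => G.mem_J_of_Phi_eq_zero K n ((TwoSidedIdeal.mem_ker _).1 ha))
    (G.J_le_ker_Phi K n)

end Words

/-! ## The graph C*-algebra -/

section CStar

variable (G : BipartiteSepGraph.{u})

/-- Words in the images of the letters lift letter by letter, so no surjectivity of f is needed. -/
theorem image_finalProjCommutators {A B ι : Type*} [Ring A] [StarRing A] [Ring B] [StarRing B]
    (f : A →+* B) (hf : ∀ a, f (star a) = star (f a)) (t : ι → A) (n : ℕ) :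
    finalProjCommutators (fun i => f (t i)) n = f '' finalProjCommutators t n := by
  have hw : words (fun i => f (t i)) n = f '' words t n := by
    ext w
    constructor
    · rintro ⟨l, h0, hl, h, rfl⟩
      obtain ⟨l', hl', rfl⟩ : ∃ l' : List A, (∀ a ∈ l', ∃ x, a = t x ∨ a = star (t x)) ∧
          l'.map f = l := by
        clear h0 hl
        induction l with
        | nil => exact ⟨[], by simp, rfl⟩
        | cons b l ih =>
          obtain ⟨l', hl', rfl⟩ := ih fun a ha => h a (by simp [ha])
          obtain ⟨x, hx⟩ := h b (by simp)
          have : ∃ a, (a = t x ∨ a = star (t x)) ∧ f a = b := by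
            rcases hx with rfl | rfl
            · exact ⟨t x, Or.inl rfl, rfl⟩
            · exact ⟨star (t x), Or.inr rfl, hf _⟩
          obtain ⟨a, ha, rfl⟩ := this
          refine ⟨a :: l', ?_, by simp⟩
          rintro c (_ | ⟨_, hc⟩)
          exacts [⟨x, ha⟩, hl' c hc]
      exact ⟨l'.prod, ⟨l', by simpa using h0, by simpa using hl, hl', rfl⟩, map_list_prod f l'⟩
    · rintro ⟨_, ⟨l, h0, hl, h, rfl⟩, rfl⟩
      refine ⟨l.map f, by simpa using h0, by simpa using hl, ?_, (map_list_prod f l).symm⟩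
      intro b hb
      obtain ⟨a, ha, rfl⟩ := List.mem_map.1 hb
      obtain ⟨x, rfl | rfl⟩ := h a ha
      · exact ⟨x, Or.inl rfl⟩
      · exact ⟨x, Or.inr (hf _)⟩
  ext c
  simp only [finalProjCommutators, hw]
  constructor
  · rintro ⟨_, ⟨w, hw, rfl⟩, _, ⟨w', hw', rfl⟩, rfl⟩
    exact ⟨_, ⟨w, hw, w', hw', rfl⟩, by simp [Ring.lie_def, finalProj, hf]⟩
  · rintro ⟨_, ⟨w, hw, w', hw', rfl⟩, rfl⟩
    exact ⟨_, ⟨w, hw, rfl⟩, _, ⟨w', hw', rfl⟩, by simp [Ring.lie_def, finalProj, hf]⟩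

theorem cstarPhi_eq_map (n : ℕ) : G.cstarPhi n = CStarEnvelope.map (G.Phi ℂ n) := by
  induction n with
  | zero => exact CStarEnvelope.map_id.symm
  | succ n ih =>
    rw [cstarPhi, ih]
    exact (CStarEnvelope.map_comp _ _).symm

theorem finalProjCommutators_cstarEdge (n : ℕ) : finalProjCommutators G.cstarEdge n =
    CStarEnvelope.of '' finalProjCommutators (Leavitt.edge ℂ (G := G)) n :=
  image_finalProjCommutators (CStarEnvelope.of (A := Leavitt ℂ G)).toRingHom
    (fun a => (CStarEnvelope.star_of a).symm) _ n

theorem _root_.subset_closedIdealSpan {R : Type*} [Ring R] [TopologicalSpace R] (s : Set R) :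
    s ⊆ closedIdealSpan s := fun _ hx =>
  (TwoSidedIdeal.mem_sInf _).2 fun _ hI => hI.1 hx

theorem _root_.isClosed_closedIdealSpan {R : Type*} [Ring R] [TopologicalSpace R] (s : Set R) :
    IsClosed (closedIdealSpan s : Set R) := by
  have : (closedIdealSpan s : Set R) =
      ⋂ I ∈ {I : TwoSidedIdeal R | s ⊆ (I : Set R) ∧ IsClosed (I : Set R)}, (I : Set R) := by
    ext x
    rw [Set.mem_iInter₂]
    exact TwoSidedIdeal.mem_sInf _
  rw [this]
  exact isClosed_biInter fun I hI => hI.2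

/-- The closed two-sided ideal generated by a self-adjoint set is self-adjoint. -/
theorem _root_.star_mem_closedIdealSpan {R : Type*} [Ring R] [StarRing R] [TopologicalSpace R]
    [ContinuousStar R] {s : Set R} (hs : ∀ x ∈ s, star x ∈ s) {x : R}
    (hx : x ∈ closedIdealSpan s) : star x ∈ closedIdealSpan s := by
  refine (TwoSidedIdeal.mem_sInf _).2 fun I hI => ?_
  -- The adjoint of I is again a closed ideal containing s, so the smallest such ideal is contained
  -- in it.
  let I' : TwoSidedIdeal R := .mk' {x | star x ∈ I}
    (by simp [I.zero_mem])
    (fun {x y} hx hy => by simpa using I.add_mem hx hy)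
    (fun {x} hx => by simpa using I.neg_mem hx)
    (fun {x y} hy => by simpa using I.mul_mem_right _ _ hy)
    (fun {x y} hx => by simpa using I.mul_mem_left _ _ hx)
  have hI' : ∀ x, x ∈ I' ↔ star x ∈ I := fun x => by simp [I']
  refine (hI' x).1 ((TwoSidedIdeal.mem_sInf _).1 hx I' ⟨fun y hy => (hI' y).2 (hI.1 (hs y hy)), ?_⟩)
  have : (I' : Set R) = star ⁻¹' (I : Set R) := Set.ext hI'
  rw [this]
  exact hI.2.preimage continuous_star

/-- The closed ideal contains the image of the algebraic kernel, since that kernel is the algebraic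
J_n, and exactness of the envelope gives one inclusion. For the other, the kernel of a continuous
map is a closed ideal, and it contains the generators by the algebraic case. -/
theorem ker_cstarPhi (n : ℕ) : TwoSidedIdeal.ker (G.cstarPhi n) = G.cstarJ n := by
  rw [cstarPhi_eq_map]
  refine le_antisymm (fun x hx => ?_) (sInf_le ⟨?_, ?_⟩)
  · refine CStarEnvelope.mem_of_map_eq_zero (G.Phi_surjective ℂ n) (G.cstarJ n)
      (fun y hy => star_mem_closedIdealSpan ?_ hy) (isClosed_closedIdealSpan _) (fun a ha => ?_)
      ((TwoSidedIdeal.mem_ker _).1 hx)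
    · rintro _ ⟨w, hw, w', hw', rfl⟩
      exact ⟨w', hw', w, hw, star_commutator_finalProj _ _⟩
    · have hle : G.J ℂ n ≤ (G.cstarJ n).comap (CStarEnvelope.of (A := Leavitt ℂ G)) := by
        rw [J, TwoSidedIdeal.span_le]
        intro c hc
        refine (TwoSidedIdeal.mem_comap _).2 (subset_closedIdealSpan _ ?_)
        rw [finalProjCommutators_cstarEdge]
        exact ⟨c, hc, rfl⟩
      exact (TwoSidedIdeal.mem_comap _).1 (hle (G.mem_J_of_Phi_eq_zero ℂ n ha))
  · rw [finalProjCommutators_cstarEdge]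
    rintro _ ⟨c, hc, rfl⟩
    refine (TwoSidedIdeal.mem_ker _).2 ?_
    have h := G.J_le_ker_Phi ℂ n (TwoSidedIdeal.subset_span hc)
    rw [CStarEnvelope.map_of, (TwoSidedIdeal.mem_ker _).1 h, map_zero]
  · have : (TwoSidedIdeal.ker (CStarEnvelope.map (G.Phi ℂ n)) : Set G.GraphCStar) =
        CStarEnvelope.map (G.Phi ℂ n) ⁻¹' {0} := Set.ext fun x => TwoSidedIdeal.mem_ker _
    rw [this]
    exact isClosed_singleton.preimage (CStarEnvelope.continuous_map _)

theorem cstarPhi_surjective (n : ℕ) : Function.Surjective (G.cstarPhi n) := by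
  rw [cstarPhi_eq_map]
  exact CStarEnvelope.map_surjective (G.Phi_surjective ℂ n)

end CStar

end BipartiteSepGraph

end

theorem theorem5p6 (G : BipartiteSepGraph.{u}) (n : ℕ) (hn : 1 ≤ n) :
    (∀ (K : Type v) [Field K] [StarRing K],
      TwoSidedIdeal.ker (G.Phi K n) = G.J K n ∧
      ∃ ψ : (G.J K n).ringCon.Quotient ≃ₐ[K] BipartiteSepGraph.Leavitt K (G.canonical n),
        (∀ a : BipartiteSepGraph.Leavitt K G, ψ ((G.J K n).ringCon.mk' a) = G.Phi K n a) ∧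
        (∀ a : BipartiteSepGraph.Leavitt K G,
          ψ ((G.J K n).ringCon.mk' (star a)) = star (ψ ((G.J K n).ringCon.mk' a)))) ∧
    (TwoSidedIdeal.ker (G.cstarPhi n) = G.cstarJ n ∧
      ∃ ψ : (G.cstarJ n).ringCon.Quotient ≃ₐ[ℂ] (G.canonical n).GraphCStar,
        (∀ a : G.GraphCStar, ψ ((G.cstarJ n).ringCon.mk' a) = G.cstarPhi n a) ∧
        (∀ a : G.GraphCStar,
          ψ ((G.cstarJ n).ringCon.mk' (star a)) = star (ψ ((G.cstarJ n).ringCon.mk' a)))) := by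
  refine ⟨fun K _ _ => ⟨G.ker_Phi K n, ?_⟩, G.ker_cstarPhi n, ?_⟩
  · exact (G.Phi K n).exists_quotient_equiv (G.Phi_surjective K n) _ (G.ker_Phi K n)
  · exact (G.cstarPhi n).exists_quotient_equiv (G.cstarPhi_surjective n) _ (G.ker_cstarPhi n)
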